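/- Let $n\ge 2$ and let $d$ be a positive even integer. For a polynomial $f\in\mathbb R[x_1,\dots,x_n]$ let $H_f$ denote its Hessian matrix, and for $r\in\mathbb N=\{0,1,2,\dots\}$ call $f$ *$r$-sos-convex* if $y^TH_f(x)y\cdot\left(\sum_i x_i^2\right)^r$ is a sum of squares of polynomials in the $2n$ variables $(x,y)$. (a) Let $f$ be a real form (homogeneous polynomial) of degree $d$ in $n$ variables. Then $H_f(x)\succ 0$ for all $x\in\mathbb R^n\setminus\{0\}$ if and only if there exist $c>0$ and $r\in\mathbb N$ such that $f(x)-c\left(\sum_i x_i^2\right)^{d/2}$ is $r$-sos-convex. (b) For each fixed $r\in\mathbb N$ this condition can be imposed as a constraint in a semidefinite program whose decision variables include the coefficients of $f$. Precisely, say that a set $S\subseteq\mathbb R^I$ ($I$ finite) is *semidefinite representable* if there are finitely many symmetric rational matrices $A_0$, $(A_i)_{i\in I}$, $(B_k)_{k\in K}$ of a common size such that for all $v\in\mathbb R^I$ $$v\in S\iff \exists u\in\mathbb R^K:\ A_0+\sum_{i\in I}v_iA_i+\sum_{k\in K}u_kB_k\succeq 0 .$$ Identify a degree-$d$ form in $n$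 variables with the vector of its coefficients. Then the following two sets are semidefinite representable: - the set of degree-$d$ forms $f$ for which there is a $c>0$ such that $f-c\left(\sum_i x_i^2\right)^{d/2}$ is $r$-sos-convex; - the set of pairs $(f,c)$ of a degree-$d$ form $f$ and a real number $c\ge 0$ such that $f-c\left(\sum_i x_i^2\right)^{d/2}$ is $r$-sos-convex. -/

import Mathlib

open MvPolynomial

noncomputable section

namespace PolyNorm

/-- The Hessian matrix `H_f` of a polynomial `f` in `n` variables, a matrix of polynomials. -/
def hessian {n : ℕ} (f : MvPolynomial (Fin n) ℝ) :
    Matrix (Fin n) (Fin n) (MvPolynomial (Fin n) ℝ) :=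
  Matrix.of fun i j => pderiv i (pderiv j f)

/-- The real matrix `H_f(x)`. -/
def hessianAt {n : ℕ} (f : MvPolynomial (Fin n) ℝ) (x : Fin n → ℝ) :
    Matrix (Fin n) (Fin n) ℝ :=
  (hessian f).map (eval x)

/-- The polynomial `∑ i, x_i ^ 2`. -/
def normSq (n : ℕ) : MvPolynomial (Fin n) ℝ := ∑ i, X i ^ 2

/-- The polynomial `yᵀ H_f(x) y` in the `2n` variables `x_i = X (Sum.inl i)` and
`y_i = X (Sum.inr i)`. -/
def hessianBiform {n : ℕ} (f : MvPolynomial (Fin n) ℝ) :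
    MvPolynomial (Fin n ⊕ Fin n) ℝ :=
  ∑ i, ∑ j, X (Sum.inr i) * rename Sum.inl (hessian f i j) * X (Sum.inr j)

/-- `f` is `r`-sos-convex: `yᵀ H_f(x) y · (∑ i, x_i ^ 2) ^ r` is a sum of squares of polynomials
in `(x, y)`. -/
def IsRSosConvex {n : ℕ} (r : ℕ) (f : MvPolynomial (Fin n) ℝ) : Prop :=
  IsSumSq (hessianBiform f * rename Sum.inl (normSq n) ^ r)

/-- The exponents of the monomials of degree `d` in `n` variables. -/
abbrev Expo (n d : ℕ) : Type :=
  {m : Fin n →₀ ℕ // m ∈ Finset.finsuppAntidiag (Finset.univ : Finset (Fin n)) d}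

/-- The form of degree `d` with coefficient vector `v`. -/
def formOf {n d : ℕ} (v : Expo n d → ℝ) : MvPolynomial (Fin n) ℝ :=
  ∑ m, monomial m.1 (v m)

/-- `S` is the set of all `v` that a linear matrix inequality
`A₀ + ∑ i, v i • A i + ∑ k, u k • B k ⪰ 0` allows, where the `u k` are additional real decision
variables and `A₀`, `A i`, `B k` are symmetric rational matrices of a common size. This is what it
means that the constraint `v ∈ S` can be imposed in a semidefinite program over `v`. -/
def IsSemidefiniteRepresentable {ι : Type} [Fintype ι] (S : Set (ι → ℝ)) : Prop :=
  ∃ (κ σ : Type) (_ : Fintype κ) (_ : Fintype σ)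
    (A₀ : Matrix σ σ ℚ) (A : ι → Matrix σ σ ℚ) (B : κ → Matrix σ σ ℚ),
    A₀.IsSymm ∧ (∀ i, (A i).IsSymm) ∧ (∀ k, (B k).IsSymm) ∧
    ∀ v : ι → ℝ, v ∈ S ↔ ∃ u : κ → ℝ,
      (A₀.map (Rat.cast : ℚ → ℝ) + ∑ i, v i • (A i).map (Rat.cast : ℚ → ℝ)
        + ∑ k, u k • (B k).map (Rat.cast : ℚ → ℝ)).PosSemidef

end PolyNorm

end

/-! Write |x|² for `normSq n`. If f - c|x|^d is r-sos-convex, cancelling |x|^(2r) at a point x ≠ 0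
gives H_f ⪰ c·H_{|x|^d}, and the right side is positive definite there.

Conversely, compactness gives H_f ⪰ μI on the unit sphere, so for small c the Hessian P of f -
c|x|^d still satisfies P ⪰ (μ/2)I there. The core is a Positivstellensatz for matrices
(`mem_sosCone_of_pos`): yᵀPy is then a sum of squares modulo |x|² - 1. Matrices with such a
certificate form a cone with order unit I, so a matrix outside it admits an extreme state that is
nonpositive on it. Extremality makes the state multiplicative over scalar polynomials
(`pure_state_smul`), so it factors through evaluation at a point z of the sphere, where P(z) ⪰
(μ/2)I forces a positive value. To remove the modulus, x/|x| is substituted for x, the values at x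
and -x are added so that odd powers of |x| cancel, and denominators are cleared with a power of |x|²
(`exists_isSumSq_mul_normSq_pow`).

For (b), a polynomial of bounded degree is a sum of squares iff it has a positive semidefinite Gram
matrix (`isSumSq_iff_exists_gramPoly`). This is a linear matrix inequality together with rational
linear equations, since the biform depends linearly on (f, c). The strict condition c > 0 becomes a
2 × 2 inequality with one auxiliary variable. -/

noncomputable section

namespace PolyNorm

/-! ### States and pure states of a cone with an order unit -/

/-- The states of the ordered vector space with positive cone `M` and unit `e`: the positive linear
functionals with value `1` at `e`, as a subset of the space of all functions. -/
def states {V : Type*} [AddCommGroup V] [Module ℝ V] (M : PointedCone ℝ V) (e : V) :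
    Set (V → ℝ) :=
  {f | (∀ v w, f (v + w) = f v + f w) ∧ (∀ (c : ℝ) v, f (c • v) = c * f v) ∧
    (∀ v ∈ M, 0 ≤ f v) ∧ f e = 1}

section States

variable {V : Type*} [AddCommGroup V] [Module ℝ V] {M : PointedCone ℝ V} {e : V}

theorem states_sub {f : V → ℝ} (hf : f ∈ states M e) (v w : V) : f (v - w) = f v - f w := by
  have h := hf.1 (v - w) w
  rw [sub_add_cancel] at h
  linarith

theorem states_le {f : V → ℝ} (hf : f ∈ states M e) {N : ℝ} {v : V} (h : N • e - v ∈ M) :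
    f v ≤ N := by
  have h1 := hf.2.2.1 _ h
  rw [states_sub hf, hf.2.1, hf.2.2.2] at h1
  linarith

/-- The order unit confines each value f v to a fixed interval, so the states form a closed subset
of a product of compact intervals, in the topology of pointwise convergence. -/
theorem isCompact_states (harch : ∀ v, ∃ N : ℝ, N • e - v ∈ M) : IsCompact (states M e) := by
  choose N hN using harch
  refine IsCompact.of_isClosed_subset
    (isCompact_univ_pi fun v => isCompact_Icc (a := -N (-v)) (b := N v)) ?_ ?_
  · have hc : ∀ v : V, Continuous fun f : V → ℝ => f v := fun v => continuous_apply v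
    have hset : states M e = (⋂ v, ⋂ w, {f : V → ℝ | f (v + w) = f v + f w}) ∩
        ((⋂ c : ℝ, ⋂ v, {f : V → ℝ | f (c • v) = c * f v}) ∩
          ((⋂ v ∈ M, {f : V → ℝ | 0 ≤ f v}) ∩ {f : V → ℝ | f e = 1})) := by
      ext f
      simp [states]
    rw [hset]
    refine IsClosed.inter ?_ (IsClosed.inter ?_ (IsClosed.inter ?_ ?_))
    · exact isClosed_iInter fun v => isClosed_iInter fun w =>
        isClosed_eq (hc _) ((hc _).add (hc _))
    · exact isClosed_iInter fun c => isClosed_iInter fun w =>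
        isClosed_eq (hc _) (continuous_const.mul (hc _))
    · exact isClosed_iInter fun v => isClosed_iInter fun _ =>
        isClosed_le continuous_const (hc _)
    · exact isClosed_eq (hc _) continuous_const
  · intro f hf v _
    refine ⟨?_, states_le hf (hN v)⟩
    have h := states_le hf (hN (-v))
    have h2 := states_sub hf 0 v
    have h3 := states_sub hf 0 0
    simp only [zero_sub, sub_self] at h2 h3
    linarith

/-- If `p` is not in the cone, some state is nonpositive at `p`. -/
theorem exists_state_nonpos (harch : ∀ v, ∃ N : ℝ, N • e - v ∈ M) (he : e ∈ M) {p : V}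
    (hp : p ∉ M) : ∃ f ∈ states M e, f p ≤ 0 := by
  have hM : ∀ {c : ℝ} {v : V}, 0 ≤ c → v ∈ M → c • v ∈ M := fun {c v} hc hv =>
    M.smul_mem hc hv
  -- Since e is an order unit, -e ∈ M would make M the whole space.
  have hne : -e ∉ M := by
    intro h
    obtain ⟨N, hN⟩ := harch (-p)
    have h1 : (|N|) • (-e) ∈ M := hM (abs_nonneg N) h
    have h2 : (|N| - N) • e ∈ M := hM (sub_nonneg.2 (le_abs_self N)) he
    apply hp
    convert M.add_mem (M.add_mem hN h1) h2 using 1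
    module
  have he0 : e ≠ 0 := by
    rintro rfl
    exact hne (by simp)
  -- The cone generated by M and -p; a functional nonnegative on it is nonpositive at p.
  let M' : PointedCone ℝ V :=
    { carrier := {v | ∃ t : ℝ, 0 ≤ t ∧ v + t • p ∈ M}
      add_mem' := by
        rintro v w ⟨s, hs, hv⟩ ⟨t, ht, hw⟩
        refine ⟨s + t, add_nonneg hs ht, ?_⟩
        convert M.add_mem hv hw using 1
        module
      zero_mem' := ⟨0, le_rfl, by simp⟩
      smul_mem' := by
        rintro c v ⟨t, ht, hv⟩
        refine ⟨c * t, mul_nonneg c.2 ht, ?_⟩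
        convert M.smul_mem c.2 hv using 1
        change (c : ℝ) • v + _ = (c : ℝ) • _
        module }
  -- The functional e ↦ 1 on the line through e is extended. It is nonnegative on M' because c • e +
  -- t • p ∈ M with c < 0 would put -e in M (t = 0) or p in M (t > 0).
  obtain ⟨g, hg1, hg2⟩ := riesz_extension M'
    (LinearPMap.mkSpanSingleton (σ := RingHom.id ℝ) e (1 : ℝ) he0) (by
      rintro ⟨x, hx⟩ ⟨t, ht, hxt⟩
      obtain ⟨c, rfl⟩ := Submodule.mem_span_singleton.1 hx
      rw [LinearPMap.mkSpanSingleton'_apply]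
      simp only [RingHom.id_apply, smul_eq_mul, mul_one]
      by_contra! hc
      change c • e + t • p ∈ M at hxt
      rcases ht.eq_or_lt with rfl | ht
      · apply hne
        convert hM (inv_nonneg.2 (neg_nonneg.2 hc.le)) hxt using 1
        simp only [zero_smul, add_zero, smul_smul]
        rw [inv_neg, neg_mul, inv_mul_cancel₀ hc.ne, neg_one_smul]
      · apply hp
        have h1 := hM (inv_nonneg.2 ht.le) hxt
        have h2 : (t⁻¹ * -c) • e ∈ M := hM (mul_nonneg (inv_nonneg.2 ht.le) (by linarith)) he
        convert M.add_mem h1 h2 using 1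
        rw [smul_add, smul_smul, smul_smul, inv_mul_cancel₀ ht.ne']
        module) (by
      intro y
      obtain ⟨N, hN⟩ := harch (-y)
      refine ⟨⟨N • e, Submodule.mem_span_singleton.2 ⟨N, rfl⟩⟩, 0, le_rfl, ?_⟩
      simpa using hN)
  refine ⟨g, ⟨g.map_add, g.map_smul, fun v hv => hg2 v ⟨0, le_rfl, by simpa using hv⟩, ?_⟩, ?_⟩
  · have := hg1 ⟨e, Submodule.mem_span_singleton_self e⟩
    rw [LinearPMap.mkSpanSingleton_apply] at this
    exact this
  · have := hg2 (-p) ⟨1, zero_le_one, by simp⟩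
    rw [map_neg] at this
    linarith

/-- If `p` is not in the cone, some pure state is nonpositive at `p`. -/
theorem exists_pure_state_nonpos (harch : ∀ v, ∃ N : ℝ, N • e - v ∈ M) (he : e ∈ M) {p : V}
    (hp : p ∉ M) : ∃ f ∈ Set.extremePoints ℝ (states M e), f p ≤ 0 := by
  obtain ⟨f, hf, hfp⟩ := exists_state_nonpos harch he hp
  -- The states minimising the value at p form a compact exposed face; by Krein–Milman it has an
  -- extreme point, which is extreme among all states.
  let l : StrongDual ℝ (V → ℝ) := -ContinuousLinearMap.proj p
  have hcomp := isCompact_states harch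
  have hexp : IsExposed ℝ (states M e) (l.toExposed (states M e)) :=
    ContinuousLinearMap.toExposed.isExposed
  obtain ⟨g, hg, hgmax⟩ := hcomp.exists_isMaxOn ⟨f, hf⟩ l.continuous.continuousOn
  obtain ⟨h, hh⟩ := (hexp.isCompact hcomp).extremePoints_nonempty ⟨g, hg, fun y hy => hgmax hy⟩
  refine ⟨h, hexp.isExtreme.extremePoints_subset_extremePoints hh, ?_⟩
  have h1 : -f p ≤ -h p := hh.1.2 f hf
  linarith

/-- A pure state `f` is proportional to every positive functional of the form `f ∘ T` that it
dominates. -/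
theorem pure_state_comp_eq {f : V → ℝ} (hf : f ∈ Set.extremePoints ℝ (states M e))
    (harch : ∀ v, ∃ N : ℝ, N • e - v ∈ M) (T : V →ₗ[ℝ] V)
    (hT : ∀ v ∈ M, T v ∈ M) (hT' : ∀ v ∈ M, v - T v ∈ M) (he : e ∈ M) (v : V) :
    f (T v) = f (T e) * f v := by
  have hs := hf.1
  -- A positive functional vanishing at the order unit is zero. Applied to T and to id - T, this
  -- settles the cases f (T e) = 0 and f (T e) = 1.
  have hzero : ∀ S : V →ₗ[ℝ] V, (∀ v ∈ M, S v ∈ M) → f (S e) = 0 → ∀ v, f (S v) = 0 := by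
    intro S hS h0 w
    have hle : ∀ w, f (S w) ≤ 0 := by
      intro w
      obtain ⟨N, hN⟩ := harch w
      have := hs.2.2.1 _ (hS _ hN)
      rw [map_sub, map_smul, states_sub hs, hs.2.1, h0] at this
      linarith
    have h1 := hle (-w)
    have h2 := states_sub hs 0 (S w)
    have h3 := states_sub hs 0 0
    simp only [zero_sub, sub_self] at h2 h3
    rw [map_neg] at h1
    linarith [hle w]
  have h0 : 0 ≤ f (T e) := hs.2.2.1 _ (hT _ he)
  have h1 : 0 ≤ f (e - T e) := hs.2.2.1 _ (hT' _ he)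
  have h1' : f (e - T e) = 1 - f (T e) := by rw [states_sub hs, hs.2.2.2]
  rcases h0.eq_or_lt with h0 | h0
  · rw [hzero T hT h0.symm, ← h0, zero_mul]
  rcases h1.eq_or_lt with h1 | h1
  · have := hzero (LinearMap.id - T) (by simpa using hT') (by simpa using h1.symm) v
    simp only [LinearMap.sub_apply, LinearMap.id_apply, states_sub hs] at this
    have h2 : f (T e) = 1 := by linarith
    rw [h2]
    linarith
  set c := f (T e)
  rw [h1'] at h1
  -- With c = f (T e) strictly between 0 and 1, f is the convex combination of the normalised
  -- functionals f ∘ T and f ∘ (id - T), so extremality identifies f with the first.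
  have m1 : (fun v => c⁻¹ * f (T v)) ∈ states M e := by
    refine ⟨fun v w => ?_, fun a v => ?_, fun v hv => ?_, inv_mul_cancel₀ h0.ne'⟩
    · simp only [map_add, hs.1]; ring
    · simp only [map_smul, hs.2.1]; ring
    · exact mul_nonneg (inv_nonneg.2 h0.le) (hs.2.2.1 _ (hT _ hv))
  have m2 : (fun v => (1 - c)⁻¹ * f (v - T v)) ∈ states M e := by
    refine ⟨fun v w => ?_, fun a v => ?_, fun v hv => ?_, ?_⟩
    · simp only [states_sub hs, map_add, hs.1]; ring
    · simp only [states_sub hs, map_smul, hs.2.1]; ring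
    · exact mul_nonneg (inv_nonneg.2 h1.le) (hs.2.2.1 _ (hT' _ hv))
    · change (1 - c)⁻¹ * f (e - T e) = 1
      rw [h1', inv_mul_cancel₀ h1.ne']
  have h2 := hf.2 m1 m2 ⟨c, 1 - c, h0, h1, by ring, by
    funext w
    simp only [Pi.add_apply, Pi.smul_apply, smul_eq_mul, states_sub hs]
    field_simp
    ring⟩
  have h3 := congrFun h2 v
  change c⁻¹ * f (T v) = f v at h3
  rw [← h3]
  field_simp

end States

/-! ### Sums of squares modulo a principal ideal -/

/-- `p` is a sum of squares modulo the principal ideal generated by `g`. -/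
def IsSumSqMod {R : Type*} [CommRing R] (g p : R) : Prop :=
  ∃ s h, IsSumSq s ∧ p = s + h * g

section IsSumSqMod

variable {R S : Type*} [CommRing R] [CommRing S] {g p q : R}

theorem _root_.IsSumSq.sumSqMod (hp : IsSumSq p) : IsSumSqMod g p :=
  ⟨p, 0, hp, by ring⟩

theorem isSumSqMod_mul_right (h : R) : IsSumSqMod g (h * g) :=
  ⟨0, h, IsSumSq.zero, by ring⟩

theorem IsSumSqMod.add (hp : IsSumSqMod g p) (hq : IsSumSqMod g q) : IsSumSqMod g (p + q) := by
  obtain ⟨s, h, hs, rfl⟩ := hp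
  obtain ⟨t, k, ht, rfl⟩ := hq
  exact ⟨s + t, h + k, hs.add ht, by ring⟩

theorem IsSumSqMod.mul (hp : IsSumSqMod g p) (hq : IsSumSqMod g q) : IsSumSqMod g (p * q) := by
  obtain ⟨s, h, hs, rfl⟩ := hp
  obtain ⟨t, k, ht, rfl⟩ := hq
  exact ⟨s * t, s * k + h * t + h * g * k, hs.mul ht, by ring⟩

theorem isSumSq_map (φ : R →+* S) {s : R} (hs : IsSumSq s) : IsSumSq (φ s) := by
  induction hs with
  | zero => simp
  | sq_add a _ ih => rw [map_add, map_mul]; exact IsSumSq.sq_add _ ih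

theorem IsSumSqMod.map (φ : R →+* S) (hp : IsSumSqMod g p) : IsSumSqMod (φ g) (φ p) := by
  obtain ⟨s, h, hs, rfl⟩ := hp
  exact ⟨φ s, φ h, isSumSq_map φ hs, by simp⟩

end IsSumSqMod

theorem isSumSq_C {σ : Type*} {c : ℝ} (hc : 0 ≤ c) : IsSumSq (C c : MvPolynomial σ ℝ) := by
  rw [← Real.mul_self_sqrt hc, C_mul]
  exact IsSumSq.mul_self _

theorem isSumSq_sq {R : Type*} [CommRing R] (a : R) : IsSumSq (a ^ 2) := by
  rw [sq]; exact IsSumSq.mul_self a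

/-! ### The Archimedean cone of sos matrices on the sphere -/

section Sphere

variable {n : ℕ}

/-- Every polynomial is bounded on the sphere, with a sum of squares certificate. -/
theorem exists_isSumSqMod_C_sub_sq (a : MvPolynomial (Fin n) ℝ) :
    ∃ N : ℝ, 0 < N ∧ IsSumSqMod (normSq n - 1) (C N - a ^ 2) := by
  induction a using MvPolynomial.induction_on with
  | C c =>
    refine ⟨c ^ 2 + 1, by positivity, ?_⟩
    rw [← C_pow, ← C_sub]
    exact (isSumSq_C (by linarith)).sumSqMod
  | add p q hp hq =>
    obtain ⟨N, hN, h1⟩ := hp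
    obtain ⟨K, hK, h2⟩ := hq
    refine ⟨2 * (N + K), by positivity, ?_⟩
    -- The parallelogram identity 2(N + K) - (p + q)² = 2((N - p²) + (K - q²)) + (p - q)².
    have h3 : IsSumSqMod (normSq n - 1) (C 2 * ((C N - p ^ 2) + (C K - q ^ 2)) + (p - q) ^ 2) :=
      ((isSumSq_C zero_le_two).sumSqMod.mul (h1.add h2)).add (isSumSq_sq _).sumSqMod
    convert h3 using 1
    have : (C 2 : MvPolynomial (Fin n) ℝ) = 2 := map_ofNat C 2
    rw [C_mul, C_add, this]
    ring
  | mul_X p i hp =>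
    obtain ⟨N, hN, h1⟩ := hp
    refine ⟨N, hN, ?_⟩
    have hX : IsSumSqMod (normSq n - 1) (1 - X i ^ 2 : MvPolynomial (Fin n) ℝ) := by
      refine ⟨∑ j ∈ Finset.univ.erase i, X j ^ 2, -1, IsSumSq.sum_sq _ _, ?_⟩
      rw [normSq, ← Finset.add_sum_erase _ _ (Finset.mem_univ i)]
      ring
    have h3 := h1.add ((isSumSq_sq p).sumSqMod.mul hX)
    convert h3 using 1
    ring

/-- The biform `yᵀ Q(x) y` of a matrix of polynomials. -/
def biform (Q : Matrix (Fin n) (Fin n) (MvPolynomial (Fin n) ℝ)) :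
    MvPolynomial (Fin n ⊕ Fin n) ℝ :=
  ∑ i, ∑ j, X (Sum.inr i) * rename Sum.inl (Q i j) * X (Sum.inr j)

variable {Q R : Matrix (Fin n) (Fin n) (MvPolynomial (Fin n) ℝ)}

theorem biform_add : biform (Q + R) = biform Q + biform R := by
  simp [biform, mul_add, add_mul, Finset.sum_add_distrib]

theorem biform_sub : biform (Q - R) = biform Q - biform R := by
  simp [biform, mul_sub, sub_mul, Finset.sum_sub_distrib]

theorem biform_smul (a : MvPolynomial (Fin n) ℝ) :
    biform (a • Q) = rename Sum.inl a * biform Q := by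
  simp only [biform, Matrix.smul_apply, smul_eq_mul, map_mul, Finset.mul_sum]
  exact Finset.sum_congr rfl fun i _ => Finset.sum_congr rfl fun j _ => by ring

theorem biform_real_smul (c : ℝ) : biform (c • Q) = C c * biform Q := by
  rw [← rename_C (Sum.inl : Fin n → Fin n ⊕ Fin n), ← biform_smul]
  congr 1
  ext1 i j
  simp [MvPolynomial.smul_eq_C_mul]

theorem biform_zero : biform (0 : Matrix (Fin n) (Fin n) (MvPolynomial (Fin n) ℝ)) = 0 := by
  simp [biform]

theorem biform_one : biform (1 : Matrix (Fin n) (Fin n) (MvPolynomial (Fin n) ℝ)) =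
    ∑ i, X (Sum.inr i) ^ 2 := by
  simp only [biform]
  refine Finset.sum_congr rfl fun i _ => ?_
  rw [Finset.sum_eq_single i]
  · simp [sq]
  · intro j _ hj
    simp [Matrix.one_apply_ne hj.symm]
  · simp

theorem biform_single (i j : Fin n) (a : MvPolynomial (Fin n) ℝ) :
    biform (Matrix.single i j a) = X (Sum.inr i) * rename Sum.inl a * X (Sum.inr j) := by
  simp only [biform]
  rw [Finset.sum_eq_single i, Finset.sum_eq_single j]
  · simp
  · intro k _ hk
    simp [hk.symm]
  · simp
  · intro k _ hk
    refine Finset.sum_eq_zero fun l _ => ?_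
    simp [hk.symm]
  · simp

/-- The polynomial `∑ i, x_i ^ 2 - 1` in the variables `(x, y)`. -/
def sphereEq (n : ℕ) : MvPolynomial (Fin n ⊕ Fin n) ℝ := rename Sum.inl (normSq n - 1)

theorem IsSumSqMod.rename_inl {a : MvPolynomial (Fin n) ℝ} (ha : IsSumSqMod (normSq n - 1) a) :
    IsSumSqMod (sphereEq n) (rename Sum.inl a) :=
  ha.map (rename (R := ℝ) (Sum.inl : Fin n → Fin n ⊕ Fin n)).toRingHom

/-- The matrices `Q` for which `yᵀ Q(x) y` is a sum of squares modulo the equation of the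
sphere. -/
def sosCone (n : ℕ) : PointedCone ℝ (Matrix (Fin n) (Fin n) (MvPolynomial (Fin n) ℝ)) where
  carrier := {Q | IsSumSqMod (sphereEq n) (biform Q)}
  add_mem' := by
    intro P Q hP hQ
    change IsSumSqMod _ _
    rw [biform_add]
    exact IsSumSqMod.add hP hQ
  zero_mem' := by
    change IsSumSqMod _ _
    rw [biform_zero]
    exact IsSumSq.zero.sumSqMod
  smul_mem' := by
    intro c Q hQ
    change IsSumSqMod _ (biform ((c : ℝ) • Q))
    rw [biform_real_smul]
    exact (isSumSq_C c.2).sumSqMod.mul hQ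

theorem mem_sosCone : Q ∈ sosCone n ↔ IsSumSqMod (sphereEq n) (biform Q) := Iff.rfl

theorem smul_mem_sosCone {a : MvPolynomial (Fin n) ℝ} (ha : IsSumSqMod (normSq n - 1) a)
    (hQ : Q ∈ sosCone n) : a • Q ∈ sosCone n := by
  rw [mem_sosCone, biform_smul]
  exact ha.rename_inl.mul hQ

theorem one_mem_sosCone : (1 : Matrix (Fin n) (Fin n) (MvPolynomial (Fin n) ℝ)) ∈ sosCone n := by
  rw [mem_sosCone, biform_one]
  exact (IsSumSq.sum_sq _ _).sumSqMod

/-- It suffices to treat a matrix with a single entry a, where 2a·y_i·y_j ≤ y_i² + a²·y_j² and a² ≤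
N on the sphere; both inequalities carry sos certificates. -/
theorem sosCone_archimedean (Q : Matrix (Fin n) (Fin n) (MvPolynomial (Fin n) ℝ)) :
    ∃ N : ℝ, N • (1 : Matrix (Fin n) (Fin n) (MvPolynomial (Fin n) ℝ)) - Q ∈ sosCone n := by
  induction Q using Matrix.induction_on' with
  | h_zero => exact ⟨0, by simp⟩
  | h_add P Q hP hQ =>
    obtain ⟨N, hN⟩ := hP
    obtain ⟨K, hK⟩ := hQ
    refine ⟨N + K, ?_⟩
    convert (sosCone n).add_mem hN hK using 1
    module
  | h_std_basis i j a =>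
    obtain ⟨N, hN, ha⟩ := exists_isSumSqMod_C_sub_sq a
    refine ⟨1 / 2 + 1 / 2 * N, ?_⟩
    rw [mem_sosCone, biform_sub, biform_real_smul, biform_one, biform_single]
    have h1 : ∀ k : Fin n, IsSumSqMod (sphereEq n)
        (∑ k, X (Sum.inr k) ^ 2 - X (Sum.inr k) ^ 2 : MvPolynomial (Fin n ⊕ Fin n) ℝ) := by
      intro k
      rw [← Finset.add_sum_erase _ _ (Finset.mem_univ k), add_sub_cancel_left]
      exact (IsSumSq.sum_sq _ _).sumSqMod
    have hhalf : IsSumSqMod (sphereEq n) (C (1 / 2) : MvPolynomial (Fin n ⊕ Fin n) ℝ) :=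
      (isSumSq_C (by norm_num)).sumSqMod
    have hC : IsSumSqMod (sphereEq n) (C N : MvPolynomial (Fin n ⊕ Fin n) ℝ) :=
      (isSumSq_C hN.le).sumSqMod
    have h2 := hhalf.mul ((((h1 i).add (hC.mul (h1 j))).add
      (isSumSq_sq (X (Sum.inr i) - rename Sum.inl a * X (Sum.inr j))).sumSqMod).add
      (ha.rename_inl.mul (isSumSq_sq (X (Sum.inr j))).sumSqMod))
    convert h2 using 1
    have h3 : (C (1 / 2) : MvPolynomial (Fin n ⊕ Fin n) ℝ) * 2 = 1 := by
      rw [← map_ofNat C 2, ← C_mul]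
      norm_num
    simp only [map_sub, map_pow, rename_C, C_add, C_mul]
    linear_combination (X (Sum.inr i) * rename Sum.inl a * X (Sum.inr j)) * h3

theorem exists_eq_transpose_mul_self {m : Type*} [Fintype m] [DecidableEq m] {G : Matrix m m ℝ}
    (hG : G.PosSemidef) : ∃ B : Matrix m m ℝ, G = B.transpose * B := by
  open scoped MatrixOrder in
  obtain ⟨B, hB⟩ := CStarAlgebra.nonneg_iff_eq_star_mul_self.mp hG.nonneg
  exact ⟨B, by simpa [Matrix.star_eq_conjTranspose] using hB⟩

theorem map_C_mem_sosCone {G : Matrix (Fin n) (Fin n) ℝ} (hG : G.PosSemidef) :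
    G.map C ∈ sosCone n := by
  obtain ⟨B, rfl⟩ := exists_eq_transpose_mul_self hG
  rw [mem_sosCone]
  refine IsSumSq.sumSqMod ?_
  have h : biform ((B.transpose * B).map C) =
      ∑ k, (∑ i, C (B k i) * X (Sum.inr i)) ^ 2 := by
    simp only [biform, Matrix.map_apply, Matrix.mul_apply, Matrix.transpose_apply, sq,
      map_sum, Finset.mul_sum, Finset.sum_mul, C_mul]
    rw [Finset.sum_comm_cycle]
    refine Finset.sum_congr rfl fun k _ => ?_
    rw [Finset.sum_comm]
    refine Finset.sum_congr rfl fun i _ => Finset.sum_congr rfl fun j _ => ?_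
    rw [map_mul, rename_C, rename_C]
    ring
  rw [h]
  exact IsSumSq.sum_sq _ _

end Sphere

/-! ### Pure states are point evaluations; Positivstellensatz on the sphere -/

section PureState

variable {n : ℕ}

/-- After scaling by 1/N, both b²/N and 1 - b²/N are sums of squares on the sphere, so
multiplication by b²/N is an operator to which `pure_state_comp_eq` applies. -/
theorem pure_state_sq_smul {f : Matrix (Fin n) (Fin n) (MvPolynomial (Fin n) ℝ) → ℝ}
    (hf : f ∈ Set.extremePoints ℝ (states (sosCone n) 1)) (b : MvPolynomial (Fin n) ℝ)
    (Q : Matrix (Fin n) (Fin n) (MvPolynomial (Fin n) ℝ)) :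
    f (b ^ 2 • Q) = f (b ^ 2 • 1) * f Q := by
  obtain ⟨N, hN, hb⟩ := exists_isSumSqMod_C_sub_sq b
  have hCN : (C N⁻¹ : MvPolynomial (Fin n) ℝ) * C N = 1 := by
    rw [← C_mul, inv_mul_cancel₀ hN.ne', C_1]
  have hC : IsSumSqMod (normSq n - 1) (C N⁻¹ : MvPolynomial (Fin n) ℝ) :=
    (isSumSq_C (inv_nonneg.2 hN.le)).sumSqMod
  have h1 : IsSumSqMod (normSq n - 1) (C N⁻¹ * b ^ 2) := hC.mul (isSumSq_sq b).sumSqMod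
  have h2 : IsSumSqMod (normSq n - 1) (1 - C N⁻¹ * b ^ 2) := by
    convert hC.mul hb using 1
    rw [mul_sub, hCN]
  have h3 := pure_state_comp_eq hf sosCone_archimedean
    ((LinearMap.lsmul (MvPolynomial (Fin n) ℝ) _ (C N⁻¹ * b ^ 2)).restrictScalars ℝ)
    (fun v hv => smul_mem_sosCone h1 hv) (fun v hv => by
      have := smul_mem_sosCone h2 hv
      rwa [sub_smul, one_smul] at this) one_mem_sosCone Q
  have h4 : ∀ R : Matrix (Fin n) (Fin n) (MvPolynomial (Fin n) ℝ),
      (C N⁻¹ * b ^ 2) • R = N⁻¹ • (b ^ 2 • R) := by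
    intro R
    rw [mul_smul, ← MvPolynomial.algebraMap_eq, algebraMap_smul]
  change f ((C N⁻¹ * b ^ 2) • Q) = f ((C N⁻¹ * b ^ 2) • 1) * f Q at h3
  rw [h4, h4, hf.1.2.1, hf.1.2.1, mul_assoc] at h3
  exact mul_left_cancel₀ (inv_ne_zero hN.ne') h3

/-- Every polynomial is a difference of squares: 4a = (a + 1)² - (a - 1)². -/
theorem pure_state_smul {f : Matrix (Fin n) (Fin n) (MvPolynomial (Fin n) ℝ) → ℝ}
    (hf : f ∈ Set.extremePoints ℝ (states (sosCone n) 1)) (a : MvPolynomial (Fin n) ℝ)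
    (Q : Matrix (Fin n) (Fin n) (MvPolynomial (Fin n) ℝ)) :
    f (a • Q) = f (a • 1) * f Q := by
  have key : ∀ R : Matrix (Fin n) (Fin n) (MvPolynomial (Fin n) ℝ),
      4 * f (a • R) = f ((a + 1) ^ 2 • R) - f ((a - 1) ^ 2 • R) := by
    intro R
    rw [← hf.1.2.1, ← states_sub hf.1]
    congr 1
    have : (4 : ℝ) • (a • R) = (4 * a) • R := by
      rw [mul_smul, ← map_ofNat C 4, ← MvPolynomial.algebraMap_eq, algebraMap_smul]
    rw [this, ← sub_smul]
    congr 1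
    ring
  have h1 := key Q
  have h2 := key 1
  rw [pure_state_sq_smul hf _ Q, pure_state_sq_smul hf _ Q] at h1
  linear_combination (1 / 4) * h1 - (1 / 4) * f Q * h2

/-- A pure state is concentrated at a point of the sphere. -/
theorem exists_pure_state_eval {f : Matrix (Fin n) (Fin n) (MvPolynomial (Fin n) ℝ) → ℝ}
    (hf : f ∈ Set.extremePoints ℝ (states (sosCone n) 1)) :
    ∃ z : Fin n → ℝ, ∑ i, z i ^ 2 = 1 ∧ ∀ (a : MvPolynomial (Fin n) ℝ)
      (Q : Matrix (Fin n) (Fin n) (MvPolynomial (Fin n) ℝ)), f (a • Q) = eval z a * f Q := by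
  let φ : MvPolynomial (Fin n) ℝ →ₐ[ℝ] ℝ := AlgHom.ofLinearMap
    { toFun := fun a => f (a • 1)
      map_add' := fun a b => by rw [add_smul, hf.1.1]
      map_smul' := fun c a => by rw [smul_assoc, hf.1.2.1]; rfl }
    (by simpa using hf.1.2.2.2) (fun a b => by
      change f ((a * b) • 1) = f (a • 1) * f (b • 1)
      rw [mul_smul, pure_state_smul hf])
  have hφ : ∀ a, eval (fun i => φ (X i)) a = f (a • 1) := by
    intro a
    change _ = φ a
    rw [aeval_unique φ, aeval_eq_eval]
    simp
    rfl
  refine ⟨fun i => φ (X i), ?_, fun a Q => by rw [hφ, pure_state_smul hf]⟩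
  -- Both signs of |x|² - 1 lie in the cone, which forces |z|² = 1.
  have h1 : ∀ c : MvPolynomial (Fin n) ℝ,
      0 ≤ f ((c * (normSq n - 1)) • 1) := fun c =>
    hf.1.2.2.1 _ (smul_mem_sosCone (isSumSqMod_mul_right c) one_mem_sosCone)
  have h2 := h1 1
  have h3 := h1 (-1)
  rw [← hφ] at h2 h3
  simp only [normSq, map_sub, map_mul, map_sum, map_pow, eval_X, map_one, map_neg] at h2 h3
  linarith

/-- A matrix of polynomials which is uniformly positive definite on the sphere is a sum of squares
modulo the equation of the sphere. -/
theorem mem_sosCone_of_pos {P : Matrix (Fin n) (Fin n) (MvPolynomial (Fin n) ℝ)} {δ : ℝ}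
    (hδ : 0 < δ) (hP : ∀ z : Fin n → ℝ, ∑ i, z i ^ 2 = 1 →
      (P.map (eval z) - δ • (1 : Matrix (Fin n) (Fin n) ℝ)).PosSemidef) : P ∈ sosCone n := by
  by_contra hmem
  obtain ⟨f, hf, hfP⟩ := exists_pure_state_nonpos sosCone_archimedean one_mem_sosCone hmem
  obtain ⟨z, hz, hfz⟩ := exists_pure_state_eval hf
  let F : Matrix (Fin n) (Fin n) (MvPolynomial (Fin n) ℝ) →+ ℝ :=
    { toFun := f
      map_zero' := by simpa using hf.1.2.1 0 0
      map_add' := hf.1.1 }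
  -- The state sees Q only through the constant matrix Q(z).
  have hsum : ∀ Q : Matrix (Fin n) (Fin n) (MvPolynomial (Fin n) ℝ),
      f Q = ∑ i, ∑ j, eval z (Q i j) * f (Matrix.single i j 1) := by
    intro Q
    conv_lhs => rw [Matrix.matrix_eq_sum_single Q]
    change F _ = _
    rw [map_sum]
    refine Finset.sum_congr rfl fun i _ => ?_
    rw [map_sum]
    refine Finset.sum_congr rfl fun j _ => ?_
    rw [← hfz, Matrix.smul_single, smul_eq_mul, mul_one]
    rfl
  have h1 := hf.1.2.2.1 _ (map_C_mem_sosCone (hP z hz))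
  have h2 : f ((P.map (eval z) - δ • (1 : Matrix (Fin n) (Fin n) ℝ)).map C) = f P - δ * f 1 := by
    rw [← hf.1.2.1, ← states_sub hf.1, hsum, hsum (P - _)]
    refine Finset.sum_congr rfl fun i _ => Finset.sum_congr rfl fun j _ => ?_
    congr 1
    by_cases h : i = j
    · subst h; simp [smul_eval]
    · simp [Matrix.one_apply_ne h]
  rw [h2, hf.1.2.2.2] at h1
  linarith

end PureState

/-! ### From the sphere to a multiplier |x|^(2r) -/

section Homogenization

variable {n : ℕ}

theorem eval_smul_of_isHomogeneous {σ : Type*} {p : MvPolynomial σ ℝ} {k : ℕ}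
    (hp : p.IsHomogeneous k) (c : ℝ) (x : σ → ℝ) :
    eval (fun i => c * x i) p = c ^ k * eval x p := by
  rw [eval_eq, eval_eq, Finset.mul_sum]
  refine Finset.sum_congr rfl fun m hm => ?_
  simp_rw [mul_pow]
  rw [Finset.prod_mul_distrib, Finset.prod_pow_eq_pow_sum, ← hp.degree_eq_sum_deg_support hm]
  ring

theorem eval_biform (Q : Matrix (Fin n) (Fin n) (MvPolynomial (Fin n) ℝ)) (x y : Fin n → ℝ) :
    eval (Sum.elim x y) (biform Q) = ∑ i, ∑ j, y i * eval x (Q i j) * y j := by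
  simp only [biform, map_sum, map_mul, eval_X, eval_rename, Sum.elim_inr]
  rfl

theorem eval_normSq (x : Fin n → ℝ) : eval x (normSq n) = ∑ i, x i ^ 2 := by
  simp [normSq]

theorem eval_rename_inl (x y : Fin n → ℝ) (p : MvPolynomial (Fin n) ℝ) :
    eval (Sum.elim x y) (rename Sum.inl p) = eval x p := by
  rw [eval_rename]; rfl

theorem sum_sq_pos {x : Fin n → ℝ} (hx : x ≠ 0) : 0 < ∑ i, x i ^ 2 := by
  obtain ⟨i, hi⟩ := Function.ne_iff.1 hx
  exact Finset.sum_pos' (fun i _ => sq_nonneg _) ⟨i, Finset.mem_univ i, by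
    have : x i ≠ 0 := hi
    positivity⟩

/-- Substituting `x / |x|` for `x` and clearing denominators splits a polynomial into an even
part and `|x|` times an odd part. -/
theorem exists_homogenization (q : MvPolynomial (Fin n ⊕ Fin n) ℝ) :
    ∃ (N : ℕ) (a b : MvPolynomial (Fin n ⊕ Fin n) ℝ),
      (∀ x y, eval (Sum.elim (fun i => -x i) y) a = eval (Sum.elim x y) a) ∧
      (∀ x y, eval (Sum.elim (fun i => -x i) y) b = -eval (Sum.elim x y) b) ∧
      ∀ (x y : Fin n → ℝ) (ρ : ℝ), 0 < ρ → ρ ^ 2 = ∑ i, x i ^ 2 →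
        eval (Sum.elim (fun i => ρ⁻¹ * x i) y) q * (ρ ^ 2) ^ N =
          eval (Sum.elim x y) a + ρ * eval (Sum.elim x y) b := by
  have hS : ∀ x y : Fin n → ℝ,
      eval (Sum.elim x y) (rename Sum.inl (normSq n)) = ∑ i, x i ^ 2 := fun x y => by
    rw [eval_rename_inl, eval_normSq]
  induction q using MvPolynomial.induction_on with
  | C c => exact ⟨0, C c, 0, by simp, by simp, by simp⟩
  | add p q hp hq =>
    obtain ⟨N, a, b, ha, hb, h⟩ := hp
    obtain ⟨K, c, d, hc, hd, h'⟩ := hq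
    refine ⟨N + K, a * rename Sum.inl (normSq n) ^ K + c * rename Sum.inl (normSq n) ^ N,
      b * rename Sum.inl (normSq n) ^ K + d * rename Sum.inl (normSq n) ^ N, ?_, ?_, ?_⟩
    · intro x y
      simp only [map_add, map_mul, map_pow, hS, ha, hc, neg_sq]
    · intro x y
      simp only [map_add, map_mul, map_pow, hS, hb, hd, neg_sq]
      ring
    · intro x y ρ hρ hx
      have h1 := h x y ρ hρ hx
      have h2 := h' x y ρ hρ hx
      simp only [map_add, map_mul, map_pow, hS, ← hx]
      linear_combination (ρ ^ 2) ^ K * h1 + (ρ ^ 2) ^ N * h2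
  | mul_X p k hp =>
    obtain ⟨N, a, b, ha, hb, h⟩ := hp
    cases k with
    | inl i =>
      -- Multiplying ρ⁻¹·x_i·(a + ρb) by ρ² gives x_i·ρ²·b + ρ·x_i·a: the two parts exchange roles
      -- and one more factor ρ² is used.
      refine ⟨N + 1, X (Sum.inl i) * rename Sum.inl (normSq n) * b, X (Sum.inl i) * a, ?_, ?_, ?_⟩
      · intro x y
        simp only [map_mul, hS, hb, neg_sq, eval_X, Sum.elim_inl]
        ring
      · intro x y
        simp only [map_mul, ha, eval_X, Sum.elim_inl]
        ring
      · intro x y ρ hρ hx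
        have h1 := h x y ρ hρ hx
        simp only [map_mul, hS, ← hx, eval_X, Sum.elim_inl]
        have h2 : ρ⁻¹ * ρ = 1 := inv_mul_cancel₀ hρ.ne'
        linear_combination (x i * ρ) * h1 +
          (eval (Sum.elim (fun i => ρ⁻¹ * x i) y) p * x i * ρ * (ρ ^ 2) ^ N) * h2
    | inr i =>
      refine ⟨N, a * X (Sum.inr i), b * X (Sum.inr i), ?_, ?_, ?_⟩
      · intro x y
        simp only [map_mul, ha, eval_X, Sum.elim_inr]
      · intro x y
        simp only [map_mul, hb, eval_X, Sum.elim_inr]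
        ring
      · intro x y ρ hρ hx
        have h1 := h x y ρ hρ hx
        simp only [map_mul, eval_X, Sum.elim_inr]
        linear_combination y i * h1

theorem isSumSq_rename_normSq_pow (k : ℕ) :
    IsSumSq (rename (Sum.inl : Fin n → Fin n ⊕ Fin n) (normSq n) ^ k) := by
  have h : IsSumSq (normSq n) := IsSumSq.sum_sq _ _
  rw [← Finset.card_range k, ← Finset.prod_const]
  exact IsSumSq.prod fun _ _ => isSumSq_map
    (rename (R := ℝ) (Sum.inl : Fin n → Fin n ⊕ Fin n)).toRingHom h

/-- A square contributes (A + ρB)² at x and (A - ρB)² at -x; their sum 2(A² + ρ²B²) is free of odd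
powers of ρ = |x|. -/
theorem exists_isSumSq_homogenization {T : MvPolynomial (Fin n ⊕ Fin n) ℝ} (hT : IsSumSq T) :
    ∃ (N : ℕ) (U : MvPolynomial (Fin n ⊕ Fin n) ℝ), IsSumSq U ∧
      ∀ (x y : Fin n → ℝ) (ρ : ℝ), 0 < ρ → ρ ^ 2 = ∑ i, x i ^ 2 →
        (eval (Sum.elim (fun i => ρ⁻¹ * x i) y) T + eval (Sum.elim (fun i => ρ⁻¹ * -x i) y) T) *
          (ρ ^ 2) ^ N = eval (Sum.elim x y) U := by
  have hS : ∀ x y : Fin n → ℝ,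
      eval (Sum.elim x y) (rename Sum.inl (normSq n)) = ∑ i, x i ^ 2 := fun x y => by
    rw [eval_rename_inl, eval_normSq]
  induction hT with
  | zero => exact ⟨0, 0, IsSumSq.zero, by simp⟩
  | sq_add q _ ih =>
    obtain ⟨K, U, hU, h⟩ := ih
    obtain ⟨N, a, b, ha, hb, hq⟩ := exists_homogenization q
    have h2 : IsSumSq (C 2 : MvPolynomial (Fin n ⊕ Fin n) ℝ) := isSumSq_C zero_le_two
    have hS1 := isSumSq_rename_normSq_pow (n := n) 1
    rw [pow_one] at hS1
    refine ⟨2 * N + K, C 2 * (a ^ 2 + rename Sum.inl (normSq n) * b ^ 2) *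
      rename Sum.inl (normSq n) ^ K + U * rename Sum.inl (normSq n) ^ (2 * N),
      ((h2.mul ((isSumSq_sq a).add (hS1.mul (isSumSq_sq b)))).mul (isSumSq_rename_normSq_pow _)).add
        (hU.mul (isSumSq_rename_normSq_pow _)), ?_⟩
    intro x y ρ hρ hx
    have h3 := h x y ρ hρ hx
    have h4 := hq x y ρ hρ hx
    have h5 := hq (fun i => -x i) y ρ hρ (by simpa using hx)
    rw [ha, hb] at h5
    simp only [map_add, map_mul, map_pow, hS, ← hx, eval_C]
    set A := eval (Sum.elim x y) a
    set B := eval (Sum.elim x y) b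
    set q₁ := eval (Sum.elim (fun i => ρ⁻¹ * x i) y) q
    set q₂ := eval (Sum.elim (fun i => ρ⁻¹ * -x i) y) q
    have h6 : (q₁ * (ρ ^ 2) ^ N) ^ 2 + (q₂ * (ρ ^ 2) ^ N) ^ 2 = 2 * (A ^ 2 + ρ ^ 2 * B ^ 2) := by
      rw [h4, h5]; ring
    have h7 : (ρ ^ 2) ^ (2 * N) = ((ρ ^ 2) ^ N) ^ 2 := by rw [mul_comm, pow_mul]
    rw [pow_add, h7]
    linear_combination (ρ ^ 2) ^ K * h6 + ((ρ ^ 2) ^ N) ^ 2 * h3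

theorem exists_isSumSq_mul_normSq_pow {P : Matrix (Fin n) (Fin n) (MvPolynomial (Fin n) ℝ)} {e : ℕ}
    (hP : P ∈ sosCone n) (hhom : ∀ i j, (P i j).IsHomogeneous (2 * e)) :
    ∃ r : ℕ, IsSumSq (biform P * rename Sum.inl (normSq n) ^ r) := by
  obtain ⟨T, h, hT, hPT⟩ := hP
  obtain ⟨N, U, hU, hTU⟩ := exists_isSumSq_homogenization hT
  -- The identity 2·yᵀPy·|x|^(2N) = |x|^(2e)·U is available only for x ≠ 0. The extra factor |x|²
  -- makes both sides vanish at x = 0.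
  refine ⟨N + 1, ?_⟩
  have key : biform P * rename Sum.inl (normSq n) ^ (N + 1) =
      C (1 / 2) * (rename Sum.inl (normSq n) ^ (e + 1) * U) := by
    refine MvPolynomial.funext fun w => ?_
    obtain ⟨x, y, rfl⟩ : ∃ x y : Fin n → ℝ, w = Sum.elim x y :=
      ⟨w ∘ Sum.inl, w ∘ Sum.inr, (Sum.elim_comp_inl_inr w).symm⟩
    simp only [map_mul, map_pow, eval_rename_inl, eval_normSq, eval_C]
    by_cases hx : x = 0
    · simp [hx]
    have hs := sum_sq_pos hx
    set s := ∑ i, x i ^ 2 with hsdef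
    have hρ : 0 < √s := Real.sqrt_pos.2 hs
    have hρs : √s ^ 2 = s := Real.sq_sqrt hs.le
    have h1 := hTU x y _ hρ hρs
    have hval : ∀ x' : Fin n → ℝ, ∑ i, x' i ^ 2 = s →
        eval (Sum.elim (fun i => (√s)⁻¹ * x' i) y) T * s ^ e = eval (Sum.elim x' y) (biform P) := by
      intro x' hx'
      have h2 := congrArg (eval (Sum.elim (fun i => (√s)⁻¹ * x' i) y)) hPT
      have h3 : eval (Sum.elim (fun i => (√s)⁻¹ * x' i) y) (sphereEq n) = 0 := by
        rw [sphereEq, eval_rename_inl, map_sub, eval_normSq]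
        simp_rw [mul_pow]
        rw [← Finset.mul_sum, hx', inv_pow, hρs, inv_mul_cancel₀ hs.ne']
        simp
      rw [map_add, map_mul, h3, mul_zero, add_zero] at h2
      rw [← h2, eval_biform, eval_biform, Finset.sum_mul]
      refine Finset.sum_congr rfl fun i _ => ?_
      rw [Finset.sum_mul]
      refine Finset.sum_congr rfl fun j _ => ?_
      rw [eval_smul_of_isHomogeneous (hhom i j), inv_pow, pow_mul, hρs]
      field_simp
    have h4 := hval x rfl
    have h5 := hval (fun i => -x i) (by simp [hsdef])
    have h6 : eval (Sum.elim (fun i => -x i) y) (biform P) =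
        eval (Sum.elim x y) (biform P) := by
      rw [eval_biform, eval_biform]
      refine Finset.sum_congr rfl fun i _ => Finset.sum_congr rfl fun j _ => ?_
      have := eval_smul_of_isHomogeneous (hhom i j) (-1) x
      rw [pow_mul] at this
      simp only [neg_mul, one_mul, even_two, Even.neg_pow, one_pow] at this
      rw [this]
    rw [h6] at h5
    rw [hρs] at h1
    rw [← h1]
    rw [pow_succ, pow_succ]
    linear_combination (-(1 / 2) * s ^ N * s) * h4 - (1 / 2 * s ^ N * s) * h5
  rw [key]
  exact (isSumSq_C (by norm_num)).mul ((isSumSq_rename_normSq_pow _).mul hU)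

end Homogenization

/-! ### Hessian bounds and the equivalence (a) -/

section Hessian

variable {n : ℕ}

/-- The commutator of two derivations is a derivation, and here it kills every variable. -/
theorem pderiv_comm {σ : Type*} (i j : σ) (p : MvPolynomial σ ℝ) :
    pderiv i (pderiv j p) = pderiv j (pderiv i p) := by
  classical
  let D : σ → Derivation ℝ (MvPolynomial σ ℝ) (MvPolynomial σ ℝ) := fun k => pderiv k
  have h : ⁅D i, D j⁆ = 0 := by
    refine MvPolynomial.derivation_ext fun k => ?_
    simp only [Derivation.commutator_apply, D, pderiv_X]
    simp [Pi.single_apply, apply_ite]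
  have h2 := congrArg (fun D => D p) h
  rw [Derivation.commutator_apply] at h2
  simpa [sub_eq_zero, D] using h2

theorem hessian_sub_C_mul (f q : MvPolynomial (Fin n) ℝ) (c : ℝ) :
    hessian (f - C c * q) = hessian f - c • hessian q := by
  ext1 i j
  simp [hessian, MvPolynomial.smul_eq_C_mul]

theorem hessianAt_isHermitian (f : MvPolynomial (Fin n) ℝ) (x : Fin n → ℝ) :
    (hessianAt f x).IsHermitian := by
  ext i j
  simp [hessianAt, hessian, pderiv_comm i j]

theorem dotProduct_map_eval_mulVec (Q : Matrix (Fin n) (Fin n) (MvPolynomial (Fin n) ℝ))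
    (x y : Fin n → ℝ) :
    star y ⬝ᵥ (Q.map (eval x)).mulVec y = eval (Sum.elim x y) (biform Q) := by
  rw [eval_biform]
  simp only [dotProduct, Matrix.mulVec, Finset.mul_sum, Matrix.map_apply, star_trivial, mul_assoc]

/-- At m = 0 the truncated exponent m - 1 is harmless, because its term carries the factor m. -/
theorem eval_biform_hessian_normSq_pow (m : ℕ) (x y : Fin n → ℝ) :
    eval (Sum.elim x y) (biform (hessian (normSq n ^ (m + 1)))) =
      2 * (m + 1) * ((∑ i, x i ^ 2) ^ m * ∑ i, y i ^ 2 +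
        2 * m * (∑ i, x i ^ 2) ^ (m - 1) * (∑ i, x i * y i) ^ 2) := by
  have h1 : ∀ j : Fin n, pderiv j (normSq n) = 2 * X j := by
    intro j
    simp only [normSq, map_sum, pderiv_pow, pderiv_X]
    rw [Finset.sum_eq_single j]
    · simp
    · intro k _ hk
      simp [hk.symm]
    · simp
  have h2 : ∀ i j : Fin n, eval x (hessian (normSq n ^ (m + 1)) i j) =
      2 * (m + 1) * ((∑ i, x i ^ 2) ^ m * (if i = j then 1 else 0) +
        2 * m * (∑ i, x i ^ 2) ^ (m - 1) * (x i * x j)) := by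
    intro i j
    simp only [hessian, Matrix.of_apply, pderiv_pow, h1, pderiv_mul, pderiv_X, Nat.add_sub_cancel,
      map_add, map_mul, map_pow, eval_normSq, eval_X, map_natCast]
    have h3 : eval x (pderiv i (2 : MvPolynomial (Fin n) ℝ)) = 0 := by
      rw [← map_ofNat C 2, pderiv_C, map_zero]
    have h4 : eval x (pderiv i ((m + 1 : ℕ) : MvPolynomial (Fin n) ℝ)) = 0 := by
      rw [← map_natCast C, pderiv_C, map_zero]
    have h5 : eval x (2 : MvPolynomial (Fin n) ℝ) = 2 := map_ofNat (eval x) 2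
    have h6 : eval x (Pi.single (M := fun _ : Fin n => MvPolynomial (Fin n) ℝ) i 1 j) =
        if i = j then 1 else 0 := by
      by_cases h : i = j
      · subst h; simp
      · simp [h]
    rw [h3, h4, h5, h6]
    push_cast
    ring
  rw [eval_biform]
  simp only [h2]
  have h7 : (∑ i, x i * y i) ^ 2 = ∑ i, ∑ j, (x i * y i) * (x j * y j) := by
    rw [sq, Finset.sum_mul_sum]
  have h8 : ∑ i, y i ^ 2 = ∑ i, ∑ j, y i * (if i = j then 1 else 0) * y j := by
    refine Finset.sum_congr rfl fun i _ => ?_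
    simp [sq]
  rw [h7, h8]
  simp only [mul_add, Finset.mul_sum, ← Finset.sum_add_distrib]
  exact Finset.sum_congr rfl fun i _ => Finset.sum_congr rfl fun j _ => by ring

theorem isSumSq_eval_nonneg {σ : Type*} {p : MvPolynomial σ ℝ} (hp : IsSumSq p) (w : σ → ℝ) :
    0 ≤ eval w p :=
  (isSumSq_map (eval w) hp).nonneg

theorem hessianAt_posDef_of_isRSosConvex {f : MvPolynomial (Fin n) ℝ} {c : ℝ} (hc : 0 < c)
    {r m : ℕ} (h : IsRSosConvex r (f - C c * normSq n ^ (m + 1))) {x : Fin n → ℝ} (hx : x ≠ 0) :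
    (hessianAt f x).PosDef := by
  refine Matrix.PosDef.of_dotProduct_mulVec_pos (hessianAt_isHermitian f x) fun y hy => ?_
  have h1 := isSumSq_eval_nonneg h (Sum.elim x y)
  change 0 ≤ eval (Sum.elim x y) (biform (hessian _) * _) at h1
  have hs := sum_sq_pos hx
  rw [map_mul, map_pow, eval_rename_inl, eval_normSq] at h1
  have h2 := nonneg_of_mul_nonneg_left h1 (pow_pos hs r)
  rw [hessian_sub_C_mul, biform_sub, biform_real_smul, map_sub, map_mul, eval_C,
    eval_biform_hessian_normSq_pow] at h2
  rw [hessianAt, dotProduct_map_eval_mulVec]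
  have h3 : 0 < 2 * ((m : ℝ) + 1) * ((∑ i, x i ^ 2) ^ m * ∑ i, y i ^ 2 +
        2 * m * (∑ i, x i ^ 2) ^ (m - 1) * (∑ i, x i * y i) ^ 2) := by
    have := sum_sq_pos hy
    positivity
  have := mul_pos hc h3
  linarith

theorem isCompact_sphere_fun : IsCompact {x : Fin n → ℝ | ∑ i, x i ^ 2 = 1} := by
  refine IsCompact.of_isClosed_subset
    (isCompact_univ_pi fun _ : Fin n => isCompact_Icc (a := (-1 : ℝ)) (b := 1)) ?_ ?_
  · exact isClosed_eq (by fun_prop) continuous_const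
  · intro x hx i _
    have h1 : x i ^ 2 ≤ ∑ i, x i ^ 2 :=
      Finset.single_le_sum (f := fun i => x i ^ 2) (fun i _ => sq_nonneg _) (Finset.mem_univ i)
    have hx' : ∑ i, x i ^ 2 = 1 := hx
    rw [hx'] at h1
    exact abs_le.1 ((sq_le_one_iff_abs_le_one _).1 h1)

/-- μ is a positive lower bound on the compact product of two spheres; homogeneity of degree 2 in y
extends it to all y. -/
theorem exists_pos_le_hessian {f : MvPolynomial (Fin n) ℝ}
    (hf : ∀ x : Fin n → ℝ, x ≠ 0 → (hessianAt f x).PosDef) :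
    ∃ μ : ℝ, 0 < μ ∧ ∀ x y : Fin n → ℝ, ∑ i, x i ^ 2 = 1 →
      μ * ∑ i, y i ^ 2 ≤ eval (Sum.elim x y) (biform (hessian f)) := by
  have hne : ∀ x : Fin n → ℝ, ∑ i, x i ^ 2 = 1 → x ≠ 0 := by
    rintro x hx rfl
    simp at hx
  have hcont : Continuous fun p : (Fin n → ℝ) × (Fin n → ℝ) =>
      eval (Sum.elim p.1 p.2) (biform (hessian f)) := by
    refine (MvPolynomial.continuous_eval _).comp (continuous_pi fun k => ?_)
    cases k with
    | inl i => exact (continuous_apply i).comp continuous_fst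
    | inr i => exact (continuous_apply i).comp continuous_snd
  obtain ⟨μ, hμ, h⟩ := (isCompact_sphere_fun.prod isCompact_sphere_fun).exists_forall_le'
    hcont.continuousOn (a := 0) (by
      rintro ⟨x, y⟩ ⟨hx, hy⟩
      rw [← dotProduct_map_eval_mulVec]
      exact (hf x (hne x hx)).dotProduct_mulVec_pos (hne y hy))
  refine ⟨μ, hμ, fun x y hx => ?_⟩
  by_cases hy : y = 0
  · subst hy
    simp [eval_biform]
  have hs := sum_sq_pos hy
  set s := ∑ i, y i ^ 2
  have hρ : 0 < √s := Real.sqrt_pos.2 hs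
  have hρs : √s ^ 2 = s := Real.sq_sqrt hs.le
  have h1 := h (x, fun i => (√s)⁻¹ * y i) ⟨hx, by
    change ∑ i, ((√s)⁻¹ * y i) ^ 2 = 1
    simp_rw [mul_pow]
    rw [← Finset.mul_sum, inv_pow, hρs, inv_mul_cancel₀ hs.ne']⟩
  have h2 : eval (Sum.elim x fun i => (√s)⁻¹ * y i) (biform (hessian f)) =
      s⁻¹ * eval (Sum.elim x y) (biform (hessian f)) := by
    rw [eval_biform, eval_biform, Finset.mul_sum]
    refine Finset.sum_congr rfl fun i _ => ?_
    rw [Finset.mul_sum]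
    refine Finset.sum_congr rfl fun j _ => ?_
    have hinv : (√s)⁻¹ ^ 2 = s⁻¹ := by rw [inv_pow, hρs]
    rw [← hinv]
    ring
  change μ ≤ eval (Sum.elim x fun i => (√s)⁻¹ * y i) (biform (hessian f)) at h1
  rw [h2] at h1
  rw [inv_mul_eq_div, le_div_iff₀ hs] at h1
  exact h1

theorem exists_isRSosConvex_of_hessianAt_posDef {f : MvPolynomial (Fin n) ℝ} {m : ℕ}
    (hfh : f.IsHomogeneous (2 * (m + 1)))
    (hf : ∀ x : Fin n → ℝ, x ≠ 0 → (hessianAt f x).PosDef) :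
    ∃ c : ℝ, 0 < c ∧ ∃ r : ℕ, IsRSosConvex r (f - C c * normSq n ^ (m + 1)) := by
  obtain ⟨μ, hμ, h⟩ := exists_pos_le_hessian hf
  -- By Cauchy–Schwarz, B bounds the Hessian of |x|^(2(m+1)) on the sphere, so c = μ/(2B) uses up at
  -- most half of μ.
  set B : ℝ := 2 * (m + 1) * (1 + 2 * m) with hB
  have hBpos : 0 < B := by positivity
  refine ⟨μ / (2 * B), by positivity, ?_⟩
  set g := f - C (μ / (2 * B)) * normSq n ^ (m + 1) with hg
  have hS : (normSq n).IsHomogeneous 2 :=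
    IsHomogeneous.sum _ _ _ fun i _ => isHomogeneous_X_pow i 2
  have hgh : g.IsHomogeneous (2 * (m + 1)) := by
    refine hfh.sub ?_
    exact (hS.pow (m + 1)).C_mul _
  refine exists_isSumSq_mul_normSq_pow (P := hessian g) (e := m) ?_ fun i j => ?_
  · refine mem_sosCone_of_pos (half_pos hμ) fun z hz => ?_
    refine Matrix.PosSemidef.of_dotProduct_mulVec_nonneg ?_ fun y => ?_
    · refine (hessianAt_isHermitian g z).sub ?_
      ext i j
      by_cases hij : i = j
      · subst hij; simp
      · simp [Matrix.one_apply_ne hij, Matrix.one_apply_ne (Ne.symm hij)]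
    · rw [Matrix.sub_mulVec, dotProduct_sub, dotProduct_map_eval_mulVec, hg, hessian_sub_C_mul,
        biform_sub, biform_real_smul, map_sub, map_mul, eval_C, eval_biform_hessian_normSq_pow, hz]
      have h1 := h z y hz
      have h2 : (∑ i, z i * y i) ^ 2 ≤ ∑ i, y i ^ 2 := by
        have := Finset.sum_mul_sq_le_sq_mul_sq Finset.univ z y
        rwa [hz, one_mul] at this
      have h3 : star y ⬝ᵥ ((μ / 2) • (1 : Matrix (Fin n) (Fin n) ℝ)).mulVec y =
          μ / 2 * ∑ i, y i ^ 2 := by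
        rw [Matrix.smul_mulVec, Matrix.one_mulVec, dotProduct_smul]
        simp [dotProduct, sq]
      rw [h3]
      have h4 : 2 * ((m : ℝ) + 1) * (1 ^ m * ∑ i, y i ^ 2 +
          2 * m * 1 ^ (m - 1) * (∑ i, z i * y i) ^ 2) ≤ B * ∑ i, y i ^ 2 := by
        rw [hB, one_pow, one_pow, one_mul, mul_one, mul_assoc (2 * ((m : ℝ) + 1))]
        refine mul_le_mul_of_nonneg_left ?_ (by positivity)
        have := mul_le_mul_of_nonneg_left h2 (show (0 : ℝ) ≤ 2 * m by positivity)
        linarith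
      have h5 := mul_le_mul_of_nonneg_left h4 (show 0 ≤ μ / (2 * B) by positivity)
      have h6 : μ / (2 * B) * (B * ∑ i, y i ^ 2) = μ / 2 * ∑ i, y i ^ 2 := by
        field_simp
      linarith
  · have := (hgh.pderiv (i := j)).pderiv (i := i)
    rwa [show 2 * (m + 1) - 1 - 1 = 2 * m by omega] at this

end Hessian

/-! ### Calculus of semidefinite representable sets -/

theorem posSemidef_fromBlocks_zero_iff {σ τ : Type*} [Fintype σ] [Fintype τ] {A : Matrix σ σ ℝ}
    {D : Matrix τ τ ℝ} :
    (Matrix.fromBlocks A 0 0 D).PosSemidef ↔ A.PosSemidef ∧ D.PosSemidef := by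
  constructor
  · intro h
    exact ⟨h.submatrix Sum.inl, h.submatrix Sum.inr⟩
  · rintro ⟨hA, hD⟩
    refine Matrix.PosSemidef.of_dotProduct_mulVec_nonneg ?_ fun x => ?_
    · exact Matrix.IsHermitian.fromBlocks hA.1 (by simp) hD.1
    · have h1 := hA.dotProduct_mulVec_nonneg (x ∘ Sum.inl)
      have h2 := hD.dotProduct_mulVec_nonneg (x ∘ Sum.inr)
      simp only [star_trivial] at h1 h2 ⊢
      rw [Matrix.fromBlocks_mulVec, Matrix.zero_mulVec, Matrix.zero_mulVec, add_zero, zero_add]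
      conv_rhs => rw [← Sum.elim_comp_inl_inr x]
      rw [sumElim_dotProduct_sumElim]
      exact add_nonneg h1 h2

theorem sum_smul_fromBlocks_zero {κ σ τ : Type*} [Fintype κ] (v : κ → ℝ) (A : κ → Matrix σ σ ℝ)
    (D : κ → Matrix τ τ ℝ) :
    ∑ k, v k • Matrix.fromBlocks (A k) 0 0 (D k) =
      Matrix.fromBlocks (∑ k, v k • A k) 0 0 (∑ k, v k • D k) := by
  ext i j
  rcases i with i | i <;> rcases j with j | j <;> simp [Matrix.sum_apply]

section Representable

variable {ι : Type} [Fintype ι]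

theorem isSemidefiniteRepresentable_lmi {σ : Type} [Fintype σ] (A₀ : Matrix σ σ ℚ)
    (A : ι → Matrix σ σ ℚ) (h₀ : A₀.IsSymm) (hA : ∀ i, (A i).IsSymm) :
    IsSemidefiniteRepresentable {v : ι → ℝ |
      (A₀.map (Rat.cast : ℚ → ℝ) + ∑ i, v i • (A i).map (Rat.cast : ℚ → ℝ)).PosSemidef} := by
  refine ⟨Empty, σ, inferInstance, inferInstance, A₀, A, fun k => k.elim, h₀, hA,
    fun k => k.elim, fun v => ?_⟩
  simp

/-- Two matrix inequalities are imposed at once by a block diagonal one, each block keeping its own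
auxiliary variables. -/
theorem IsSemidefiniteRepresentable.inter {S T : Set (ι → ℝ)} (hS : IsSemidefiniteRepresentable S)
    (hT : IsSemidefiniteRepresentable T) : IsSemidefiniteRepresentable (S ∩ T) := by
  obtain ⟨κ, σ, _, _, A₀, A, B, hA₀, hA, hB, h⟩ := hS
  obtain ⟨κ', σ', _, _, A₀', A', B', hA₀', hA', hB', h'⟩ := hT
  refine ⟨κ ⊕ κ', σ ⊕ σ', inferInstance, inferInstance, Matrix.fromBlocks A₀ 0 0 A₀',
    fun i => Matrix.fromBlocks (A i) 0 0 (A' i),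
    Sum.elim (fun k => Matrix.fromBlocks (B k) 0 0 0) (fun k => Matrix.fromBlocks 0 0 0 (B' k)),
    hA₀.fromBlocks (by simp) hA₀', fun i => (hA i).fromBlocks (by simp) (hA' i), ?_, fun v => ?_⟩
  · rintro (k | k)
    · exact (hB k).fromBlocks (by simp) Matrix.isSymm_zero
    · exact Matrix.isSymm_zero.fromBlocks (by simp) (hB' k)
  · have key : ∀ u : κ ⊕ κ' → ℝ,
        (Matrix.fromBlocks A₀ 0 0 A₀').map (Rat.cast : ℚ → ℝ) +
          ∑ i, v i • (Matrix.fromBlocks (A i) 0 0 (A' i)).map (Rat.cast : ℚ → ℝ) +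
          ∑ k, u k • ((Sum.elim (fun k => Matrix.fromBlocks (B k) 0 0 0)
            (fun k => Matrix.fromBlocks 0 0 0 (B' k)) k : Matrix (σ ⊕ σ') (σ ⊕ σ') ℚ)).map
              (Rat.cast : ℚ → ℝ) =
        Matrix.fromBlocks
          (A₀.map (Rat.cast : ℚ → ℝ) + ∑ i, v i • (A i).map (Rat.cast : ℚ → ℝ)
            + ∑ k, u (Sum.inl k) • (B k).map (Rat.cast : ℚ → ℝ)) 0 0
          (A₀'.map (Rat.cast : ℚ → ℝ) + ∑ i, v i • (A' i).map (Rat.cast : ℚ → ℝ)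
            + ∑ k, u (Sum.inr k) • (B' k).map (Rat.cast : ℚ → ℝ)) := by
      intro u
      have h0 : ∀ {α β : Type}, (0 : Matrix α β ℚ).map (Rat.cast : ℚ → ℝ) = 0 := fun {α β} =>
        Matrix.map_zero _ Rat.cast_zero
      rw [Fintype.sum_sum_type]
      simp only [Sum.elim_inl, Sum.elim_inr, Matrix.fromBlocks_map, h0, sum_smul_fromBlocks_zero,
        Matrix.fromBlocks_add, smul_zero, Finset.sum_const_zero, add_zero, zero_add]
    simp only [key, posSemidef_fromBlocks_zero_iff, Set.mem_inter_iff, h, h']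
    constructor
    · rintro ⟨⟨u, hu⟩, u', hu'⟩
      exact ⟨Sum.elim u u', hu, hu'⟩
    · rintro ⟨u, hu, hu'⟩
      exact ⟨⟨_, hu⟩, _, hu'⟩

theorem IsSemidefiniteRepresentable.proj {κ : Type} [Fintype κ] {T : Set (ι ⊕ κ → ℝ)}
    (hT : IsSemidefiniteRepresentable T) :
    IsSemidefiniteRepresentable {v : ι → ℝ | ∃ u : κ → ℝ, Sum.elim v u ∈ T} := by
  obtain ⟨κ', σ, _, _, A₀, A, B, hA₀, hA, hB, h⟩ := hT
  refine ⟨κ ⊕ κ', σ, inferInstance, inferInstance, A₀, fun i => A (Sum.inl i),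
    Sum.elim (fun k => A (Sum.inr k)) B, hA₀, fun i => hA _, ?_, fun v => ?_⟩
  · rintro (k | k)
    · exact hA _
    · exact hB _
  · simp only [Set.mem_ofPred_eq, h, Fintype.sum_sum_type, Sum.elim_inl, Sum.elim_inr]
    constructor
    · rintro ⟨u, u', hu⟩
      refine ⟨Sum.elim u u', ?_⟩
      simpa only [Sum.elim_inl, Sum.elim_inr, add_assoc] using hu
    · rintro ⟨u, hu⟩
      refine ⟨fun k => u (Sum.inl k), fun k => u (Sum.inr k), ?_⟩
      simpa only [add_assoc] using hu

theorem isSemidefiniteRepresentable_linear_nonneg {J : Type} [Fintype J] (a : ι → J → ℚ) :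
    IsSemidefiniteRepresentable {v : ι → ℝ | ∀ j, 0 ≤ ∑ i, v i * a i j} := by
  classical
  have h := isSemidefiniteRepresentable_lmi (0 : Matrix J J ℚ) (fun i => Matrix.diagonal (a i))
    Matrix.isSymm_zero (fun i => Matrix.isSymm_diagonal _)
  convert h using 1
  ext v
  have key : (0 : Matrix J J ℚ).map (Rat.cast : ℚ → ℝ) +
      ∑ i, v i • (Matrix.diagonal (a i)).map (Rat.cast : ℚ → ℝ) =
      Matrix.diagonal fun j => ∑ i, v i * (a i j : ℝ) := by
    ext j k
    by_cases hjk : j = k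
    · subst hjk
      simp [Matrix.sum_apply]
    · simp [Matrix.sum_apply, Matrix.diagonal_apply_ne _ hjk]
  simp only [Set.mem_ofPred_eq, key, Matrix.posSemidef_diagonal_iff]

theorem isSemidefiniteRepresentable_linear_eq {J : Type} [Fintype J] (a : ι → J → ℚ) :
    IsSemidefiniteRepresentable {v : ι → ℝ | ∀ j, ∑ i, v i * a i j = 0} := by
  convert (isSemidefiniteRepresentable_linear_nonneg a).inter
    (isSemidefiniteRepresentable_linear_nonneg fun i j => -a i j) using 1
  ext v
  simp only [Set.mem_inter_iff, Set.mem_ofPred_eq, Rat.cast_neg, mul_neg, Finset.sum_neg_distrib,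
    ← forall_and]
  exact forall_congr' fun j => ⟨fun h => by simp [h], fun h => by linarith [h.1, h.2]⟩

theorem posSemidef_one_offDiag_iff {c t : ℝ} :
    (!![c, 1; 1, t] : Matrix (Fin 2) (Fin 2) ℝ).PosSemidef ↔ 0 < c ∧ 1 ≤ c * t := by
  constructor
  · intro h
    have h1 : 0 ≤ c := h.diag_nonneg (i := 0)
    have h2 := h.det_nonneg
    rw [Matrix.det_fin_two_of] at h2
    refine ⟨h1.lt_of_ne ?_, by linarith⟩
    rintro rfl
    linarith
  · rintro ⟨hc, hct⟩
    refine Matrix.PosSemidef.of_dotProduct_mulVec_nonneg ?_ fun x => ?_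
    · ext i j
      fin_cases i <;> fin_cases j <;> simp
    · simp only [dotProduct, Matrix.mulVec, Fin.sum_univ_two, star_trivial, Matrix.of_apply,
        Matrix.cons_val_zero, Matrix.cons_val_one]
      have h1 : 0 ≤ c * (x 0 * (c * x 0 + 1 * x 1) + x 1 * (1 * x 0 + t * x 1)) := by
        have h2 := mul_nonneg (sub_nonneg.2 hct) (sq_nonneg (x 1))
        linarith [sq_nonneg (c * x 0 + x 1)]
      exact nonneg_of_mul_nonneg_right h1 hc

/-- This open condition is the projection of a closed one: c > 0 iff ct ≥ 1 for some t, with c ≥ 0,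
which is a 2 × 2 semidefinite constraint. -/
theorem isSemidefiniteRepresentable_pos (i : ι) :
    IsSemidefiniteRepresentable {v : ι → ℝ | 0 < v i} := by
  classical
  have h := (isSemidefiniteRepresentable_lmi (ι := ι ⊕ Unit) (!![0, 1; 1, 0])
    (Sum.elim (fun k => if k = i then !![1, 0; 0, 0] else 0) (fun _ => !![0, 0; 0, 1]))
    (by ext i j; fin_cases i <;> fin_cases j <;> rfl) (by
      rintro (k | k)
      · by_cases hk : k = i
        · simp only [Sum.elim_inl, hk, if_true]
          ext i j; fin_cases i <;> fin_cases j <;> rfl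
        · simp [hk]
      · ext i j; fin_cases i <;> fin_cases j <;> rfl)).proj
  convert h using 1
  ext v
  have key : ∀ u : Unit → ℝ, (!![0, 1; 1, 0] : Matrix (Fin 2) (Fin 2) ℚ).map (Rat.cast : ℚ → ℝ) +
      ∑ k, Sum.elim v u k • (Sum.elim (fun k => if k = i then !![1, 0; 0, 0] else 0)
        (fun _ => !![0, 0; 0, 1]) k : Matrix (Fin 2) (Fin 2) ℚ).map (Rat.cast : ℚ → ℝ) =
      !![v i, 1; 1, u ()] := by
    intro u
    rw [Fintype.sum_sum_type, Finset.sum_eq_single i]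
    · ext j k
      fin_cases j <;> fin_cases k <;> simp
    · intro k _ hk
      simp [hk]
    · simp
  simp only [Set.mem_ofPred_eq, key, posSemidef_one_offDiag_iff]
  constructor
  · intro hv
    exact ⟨fun _ => (v i)⁻¹, hv, (mul_inv_cancel₀ hv.ne').ge⟩
  · rintro ⟨u, hv, -⟩
    exact hv

end Representable

/-! ### No cancellation of leading terms in sums of squares -/

section DegreeBound

variable {τ : Type*}

theorem leadingCoeff_add_nonneg (m : MonomialOrder τ) {p q : MvPolynomial τ ℝ}
    (hp : 0 ≤ m.leadingCoeff p) (hq : 0 ≤ m.leadingCoeff q) :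
    m.toSyn (m.degree p) ≤ m.toSyn (m.degree (p + q)) ∧ 0 ≤ m.leadingCoeff (p + q) := by
  rcases lt_trichotomy (m.toSyn (m.degree p)) (m.toSyn (m.degree q)) with h | h | h
  · rw [m.degree_add_eq_right_of_lt h, add_comm, m.leadingCoeff_add_of_lt h]
    exact ⟨h.le, hq⟩
  · by_cases hp0 : p = 0
    · subst hp0
      rw [zero_add, m.degree_zero, map_zero]
      exact ⟨bot_le, hq⟩
    have hdeg : m.degree p = m.degree q := m.toSyn.injective h
    have hpos : 0 < m.leadingCoeff p := hp.lt_of_ne (m.leadingCoeff_ne_zero_iff.2 hp0).symm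
    have hc : 0 < coeff (m.degree p) (p + q) := by
      rw [coeff_add]
      have : 0 ≤ coeff (m.degree p) q := by rw [hdeg]; exact hq
      exact add_pos_of_pos_of_nonneg hpos this
    have h1 := m.le_degree (mem_support_iff.2 hc.ne')
    have h2 : m.degree (p + q) = m.degree p := by
      refine m.toSyn.injective (le_antisymm ?_ h1)
      exact m.degree_add_le.trans (by rw [← h, sup_idem])
    refine ⟨h1, ?_⟩
    rw [MonomialOrder.leadingCoeff, h2]
    exact hc.le
  · rw [m.degree_add_of_lt h, m.leadingCoeff_add_of_lt h]
    exact ⟨le_rfl, hp⟩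

theorem isSumSq_leadingCoeff_nonneg (m : MonomialOrder τ) {s : MvPolynomial τ ℝ}
    (hs : IsSumSq s) : 0 ≤ m.leadingCoeff s := by
  induction hs with
  | zero => simp
  | sq_add a _ ih =>
    refine (leadingCoeff_add_nonneg m ?_ ih).2
    rw [m.leadingCoeff_mul]
    exact mul_self_nonneg _

/-- In a graded order the leading monomial determines the total degree, and nonnegative leading
coefficients cannot cancel. This bounds the degree of every square in a representation, hence the
size of the Gram matrix. -/
theorem totalDegree_le_totalDegree_add {s t : MvPolynomial τ ℝ} (hs : IsSumSq s)
    (ht : IsSumSq t) : s.totalDegree ≤ (s + t).totalDegree := by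
  cases exists_wellFoundedGT τ
  exact degLex_totalDegree_monotone (leadingCoeff_add_nonneg _
    (isSumSq_leadingCoeff_nonneg _ hs) (isSumSq_leadingCoeff_nonneg _ ht)).1

end DegreeBound

/-! ### Gram matrices -/

section Gram

variable {τ : Type} [Finite τ]

/-- The exponents of degree at most `D`. -/
abbrev ExpoLE (τ : Type) (D : ℕ) : Type := {m : τ →₀ ℕ // m.degree ≤ D}

instance (D : ℕ) : Finite (ExpoLE τ D) := (Finsupp.finite_of_degree_le D).to_subtype

instance (D : ℕ) : Fintype (ExpoLE τ D) := Fintype.ofFinite _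

/-- The polynomial with Gram matrix `G` in the monomials of degree at most `D`. -/
def gramPoly {D : ℕ} (G : Matrix (ExpoLE τ D) (ExpoLE τ D) ℝ) : MvPolynomial τ ℝ :=
  ∑ e, ∑ e', monomial (e.1 + e'.1) (G e e')

theorem gramPoly_add {D : ℕ} (G H : Matrix (ExpoLE τ D) (ExpoLE τ D) ℝ) :
    gramPoly (G + H) = gramPoly G + gramPoly H := by
  simp [gramPoly, Finset.sum_add_distrib]

theorem gramPoly_sum {D : ℕ} {κ : Type*} (s : Finset κ)
    (G : κ → Matrix (ExpoLE τ D) (ExpoLE τ D) ℝ) :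
    gramPoly (∑ k ∈ s, G k) = ∑ k ∈ s, gramPoly (G k) := by
  classical
  induction s using Finset.induction_on with
  | empty => simp [gramPoly]
  | insert k s hk ih => rw [Finset.sum_insert hk, Finset.sum_insert hk, gramPoly_add, ih]

theorem gramPoly_vecMulVec {D : ℕ} (c : ExpoLE τ D → ℝ) :
    gramPoly (Matrix.vecMulVec c c) = (∑ e, monomial e.1 (c e)) * ∑ e, monomial e.1 (c e) := by
  simp only [gramPoly, Finset.sum_mul_sum, monomial_mul, Matrix.vecMulVec_apply]

theorem sum_expoLE_monomial {D : ℕ} {a : MvPolynomial τ ℝ} (ha : a.totalDegree ≤ D) :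
    ∑ e : ExpoLE τ D, monomial e.1 (coeff e.1 a) = a := by
  classical
  ext m
  simp only [coeff_sum, coeff_monomial]
  by_cases hm : m.degree ≤ D
  · rw [Finset.sum_eq_single ⟨m, hm⟩]
    · simp
    · intro e _ he
      rw [if_neg fun h => he (Subtype.ext h)]
    · simp
  · have h0 : coeff m a = 0 := by
      by_contra h
      exact hm ((le_totalDegree (mem_support_iff.2 h)).trans ha)
    rw [h0]
    refine Finset.sum_eq_zero fun e _ => ?_
    rw [if_neg]
    rintro rfl
    exact hm e.2

theorem isSumSq_iff_exists_gramPoly {D : ℕ} {p : MvPolynomial τ ℝ} (hp : p.totalDegree ≤ 2 * D) :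
    IsSumSq p ↔ ∃ G : Matrix (ExpoLE τ D) (ExpoLE τ D) ℝ, G.PosSemidef ∧ gramPoly G = p := by
  classical
  constructor
  · intro h
    induction h with
    | zero => exact ⟨0, Matrix.PosSemidef.zero, by simp [gramPoly]⟩
    | @sq_add a s hs ih =>
      have ha : IsSumSq (a * a) := IsSumSq.mul_self a
      have h1 := (totalDegree_le_totalDegree_add ha hs).trans hp
      have h2 : s.totalDegree ≤ 2 * D :=
        (totalDegree_le_totalDegree_add hs ha).trans (by rwa [add_comm])
      obtain ⟨G, hG, rfl⟩ := ih h2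
      have h3 : a.totalDegree ≤ D := by
        by_cases ha0 : a = 0
        · simp [ha0]
        · rw [totalDegree_mul_of_isDomain ha0 ha0] at h1
          omega
      refine ⟨Matrix.vecMulVec (fun e => coeff e.1 a) (fun e => coeff e.1 a) + G,
        Matrix.PosSemidef.add ?_ hG, ?_⟩
      · exact Matrix.posSemidef_vecMulVec_self_star _
      · rw [gramPoly_add, gramPoly_vecMulVec, sum_expoLE_monomial h3]
  · rintro ⟨G, hG, rfl⟩
    obtain ⟨B, rfl⟩ := exists_eq_transpose_mul_self hG
    have h : B.transpose * B = ∑ k, Matrix.vecMulVec (B k) (B k) := by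
      ext i j
      simp [Matrix.mul_apply, Matrix.sum_apply, Matrix.vecMulVec_apply]
    rw [h, gramPoly_sum]
    simp only [gramPoly_vecMulVec]
    exact IsSumSq.sum_mul_self _ _

theorem totalDegree_gramPoly_le {D : ℕ} (G : Matrix (ExpoLE τ D) (ExpoLE τ D) ℝ) :
    (gramPoly G).totalDegree ≤ 2 * D := by
  refine totalDegree_finsetSum_le fun e _ => totalDegree_finsetSum_le fun e' _ => ?_
  refine (totalDegree_monomial_le _ _).trans ?_
  change (e.1 + e'.1).degree ≤ _
  have h1 := e.2
  have h2 := e'.2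
  rw [map_add]
  omega

theorem eq_of_coeff_eq_of_totalDegree_le {D : ℕ} {p q : MvPolynomial τ ℝ}
    (hp : p.totalDegree ≤ D) (hq : q.totalDegree ≤ D)
    (h : ∀ m : ExpoLE τ D, coeff m.1 p = coeff m.1 q) : p = q := by
  rw [← sum_expoLE_monomial hp, ← sum_expoLE_monomial hq]
  simp only [h]

/-- The set of parameters for which a rational linear combination of polynomials is a sum of squares
is semidefinite representable. -/
theorem isSemidefiniteRepresentable_isSumSq {ι : Type} [Fintype ι] (L : ι → MvPolynomial τ ℝ)
    (hL : ∀ i m, ∃ q : ℚ, coeff m (L i) = q) :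
    IsSemidefiniteRepresentable {v : ι → ℝ | IsSumSq (∑ i, v i • L i)} := by
  classical
  choose ℓ hℓ using hL
  obtain ⟨D, hD⟩ : ∃ D, ∀ i, (L i).totalDegree ≤ 2 * D :=
    ⟨∑ i, (L i).totalDegree, fun i => by
      have := Finset.single_le_sum (f := fun i => (L i).totalDegree) (fun _ _ => Nat.zero_le _)
        (Finset.mem_univ i)
      omega⟩
  let E := ExpoLE τ D
  -- The Gram matrix is parametrised as U + Uᵀ with U arbitrary, which keeps the coefficient
  -- matrices symmetric and produces the -2 in the linear equations below.
  have h1 := isSemidefiniteRepresentable_lmi (ι := ι ⊕ E × E) (0 : Matrix E E ℚ)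
    (Sum.elim (fun _ => 0) fun p => Matrix.single p.1 p.2 1 + Matrix.single p.2 p.1 1)
    Matrix.isSymm_zero (by
      rintro (i | p)
      · exact Matrix.isSymm_zero
      · simp [Matrix.IsSymm, add_comm])
  have h2 := isSemidefiniteRepresentable_linear_eq (ι := ι ⊕ E × E) (J := ExpoLE τ (2 * D))
    (Sum.elim (fun i m => ℓ i m.1) fun p m => if p.1.1 + p.2.1 = m.1 then -2 else 0)
  convert (h1.inter h2).proj using 1
  ext v
  have hdeg : (∑ i, v i • L i).totalDegree ≤ 2 * D :=
    totalDegree_finsetSum_le fun i _ => (totalDegree_smul_le _ _).trans (hD i)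
  simp only [Set.mem_ofPred_eq, Set.mem_inter_iff]
  rw [isSumSq_iff_exists_gramPoly hdeg]
  have hmat : ∀ U : E × E → ℝ, (0 : Matrix E E ℚ).map (Rat.cast : ℚ → ℝ) +
      ∑ k, Sum.elim v U k • (Sum.elim (fun _ => 0)
        (fun p => Matrix.single p.1 p.2 1 + Matrix.single p.2 p.1 1) k : Matrix E E ℚ).map
          (Rat.cast : ℚ → ℝ) = Matrix.of fun e e' => U (e, e') + U (e', e) := by
    intro U
    ext e e'
    simp only [Fintype.sum_sum_type, Matrix.add_apply, Matrix.sum_apply, Matrix.smul_apply,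
      Matrix.map_apply, Sum.elim_inl, Sum.elim_inr, Matrix.zero_apply, Matrix.of_apply,
      Rat.cast_zero, mul_zero, Finset.sum_const_zero, zero_add, smul_eq_mul, Rat.cast_add,
      mul_add, Finset.sum_add_distrib, Matrix.single_apply, Fintype.sum_prod_type]
    congr 1
    · rw [Finset.sum_eq_single e, Finset.sum_eq_single e'] <;> simp +contextual
    · rw [Finset.sum_eq_single e', Finset.sum_eq_single e] <;> simp +contextual
  have hcoeff : ∀ (U : E × E → ℝ) (m : ExpoLE τ (2 * D)),
      ∑ k, Sum.elim v U k * ((Sum.elim (fun i m => ℓ i m.1)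
        (fun p m => if p.1.1 + p.2.1 = m.1 then -2 else 0) k m : ℚ) : ℝ) =
      coeff m.1 (∑ i, v i • L i) -
        coeff m.1 (gramPoly (Matrix.of fun e e' : E => U (e, e') + U (e', e))) := by
    intro U m
    have hsymm : gramPoly (Matrix.of fun e e' : E => U (e, e') + U (e', e)) =
        ∑ e : E, ∑ e' : E, monomial (e.1 + e'.1) (2 * U (e, e')) := by
      simp only [gramPoly, Matrix.of_apply, map_add, Finset.sum_add_distrib, two_mul]
      congr 1
      rw [Finset.sum_comm]
      exact Finset.sum_congr rfl fun e _ => Finset.sum_congr rfl fun e' _ => by rw [add_comm]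
    rw [hsymm, Fintype.sum_sum_type, sub_eq_add_neg]
    simp only [Sum.elim_inl, Sum.elim_inr, coeff_sum, coeff_smul, hℓ, smul_eq_mul, coeff_monomial,
      Fintype.sum_prod_type, ← Finset.sum_neg_distrib]
    congr 1
    refine Finset.sum_congr rfl fun e _ => Finset.sum_congr rfl fun e' _ => ?_
    split_ifs <;> simp [mul_comm]
  simp only [hmat, hcoeff, sub_eq_zero]
  constructor
  · rintro ⟨G, hG, hGp⟩
    have hG2 : (Matrix.of fun e e' : E => 1 / 2 * G e e' + 1 / 2 * G e' e) = G := by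
      ext e e'
      have h := hG.1.apply e e'
      simp only [star_trivial] at h
      rw [Matrix.of_apply, h]
      ring
    refine ⟨fun p => 1 / 2 * G p.1 p.2, ?_⟩
    dsimp only
    rw [hG2, hGp]
    exact ⟨hG, fun _ => rfl⟩
  · rintro ⟨U, hU, hUp⟩
    exact ⟨_, hU, (eq_of_coeff_eq_of_totalDegree_le hdeg (totalDegree_gramPoly_le _) hUp).symm⟩

end Gram

/-! ### Rational coefficients and linearity in (f, c) -/

section Rational

/-- The polynomials with rational coefficients, as a subring of the real polynomials. -/
def ratPoly (τ : Type*) : Subring (MvPolynomial τ ℝ) :=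
  (MvPolynomial.map (σ := τ) (algebraMap ℚ ℝ)).range

variable {τ υ : Type*} {p : MvPolynomial τ ℝ}

theorem exists_rat_coeff (hp : p ∈ ratPoly τ) (m : τ →₀ ℕ) : ∃ q : ℚ, coeff m p = q := by
  obtain ⟨p, rfl⟩ := hp
  exact ⟨coeff m p, by rw [coeff_map]; rfl⟩

theorem X_mem_ratPoly (i : τ) : X i ∈ ratPoly τ := ⟨X i, map_X _ i⟩

theorem monomial_one_mem_ratPoly (m : τ →₀ ℕ) : monomial m 1 ∈ ratPoly τ :=
  ⟨monomial m 1, by simp⟩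

theorem pderiv_mem_ratPoly (i : τ) (hp : p ∈ ratPoly τ) : pderiv i p ∈ ratPoly τ := by
  obtain ⟨p, rfl⟩ := hp
  exact ⟨pderiv i p, pderiv_map.symm⟩

theorem rename_mem_ratPoly (f : τ → υ) (hp : p ∈ ratPoly τ) : rename f p ∈ ratPoly υ := by
  obtain ⟨p, rfl⟩ := hp
  exact ⟨rename f p, map_rename _ _ _⟩

theorem normSq_mem_ratPoly (n : ℕ) : normSq n ∈ ratPoly (Fin n) :=
  sum_mem fun i _ => pow_mem (X_mem_ratPoly i) 2

theorem hessianBiform_mem_ratPoly {n : ℕ} {f : MvPolynomial (Fin n) ℝ}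
    (hf : f ∈ ratPoly (Fin n)) : hessianBiform f ∈ ratPoly (Fin n ⊕ Fin n) :=
  sum_mem fun _ _ => sum_mem fun _ _ => mul_mem (mul_mem (X_mem_ratPoly _)
    (rename_mem_ratPoly _ (pderiv_mem_ratPoly _ (pderiv_mem_ratPoly _ hf)))) (X_mem_ratPoly _)

end Rational

/-- The biform of the Hessian as a linear map. -/
def hessianBiformₗ (n : ℕ) : MvPolynomial (Fin n) ℝ →ₗ[ℝ] MvPolynomial (Fin n ⊕ Fin n) ℝ where
  toFun := hessianBiform
  map_add' f g := by
    change biform (hessian (f + g)) = biform (hessian f) + biform (hessian g)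
    rw [← biform_add]
    congr 1
    ext1 i j
    simp [hessian]
  map_smul' c f := by
    change biform (hessian (c • f)) = c • biform (hessian f)
    rw [MvPolynomial.smul_eq_C_mul, MvPolynomial.smul_eq_C_mul, ← biform_real_smul]
    congr 1
    ext1 i j
    simp [hessian, MvPolynomial.smul_eq_C_mul]

theorem isSemidefiniteRepresentable_isRSosConvex (n d k r : ℕ) :
    IsSemidefiniteRepresentable {w : Expo n d ⊕ Unit → ℝ |
      IsRSosConvex r (formOf (fun m => w (Sum.inl m)) - C (w (Sum.inr ())) * normSq n ^ k)} := by
  let S : MvPolynomial (Fin n ⊕ Fin n) ℝ := rename Sum.inl (normSq n) ^ r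
  have hS : S ∈ ratPoly _ := pow_mem (rename_mem_ratPoly _ (normSq_mem_ratPoly n)) r
  have h := isSemidefiniteRepresentable_isSumSq
    (Sum.elim (fun m : Expo n d => hessianBiform (monomial m.1 1) * S)
      (fun _ : Unit => -(hessianBiform (normSq n ^ k) * S))) (by
    rintro (m | _)
    · exact exists_rat_coeff
        (mul_mem (hessianBiform_mem_ratPoly (monomial_one_mem_ratPoly m.1)) hS)
    · exact exists_rat_coeff
        (neg_mem (mul_mem (hessianBiform_mem_ratPoly (pow_mem (normSq_mem_ratPoly n) k)) hS)))
  convert h using 1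
  ext w
  have key : hessianBiform (formOf (fun m => w (Sum.inl m)) - C (w (Sum.inr ())) * normSq n ^ k) =
      ∑ m : Expo n d, w (Sum.inl m) • hessianBiform (monomial m.1 1) -
        w (Sum.inr ()) • hessianBiform (normSq n ^ k) := by
    change hessianBiformₗ n _ =
      ∑ m : Expo n d, w (Sum.inl m) • hessianBiformₗ n (monomial m.1 1) -
        w (Sum.inr ()) • hessianBiformₗ n (normSq n ^ k)
    rw [map_sub, ← MvPolynomial.smul_eq_C_mul, map_smul, formOf, map_sum]
    congr 1
    refine Finset.sum_congr rfl fun m _ => ?_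
    rw [← map_smul, smul_monomial, smul_eq_mul, mul_one]
  simp only [Set.mem_ofPred_eq, IsRSosConvex]
  rw [key, Fintype.sum_sum_type, sub_mul, Finset.sum_mul]
  simp [S, sub_eq_add_neg]

theorem isSemidefiniteRepresentable_nonneg {ι : Type} [Fintype ι] (i : ι) :
    IsSemidefiniteRepresentable {v : ι → ℝ | 0 ≤ v i} := by
  classical
  convert isSemidefiniteRepresentable_linear_nonneg (J := Unit)
    (fun k _ => if k = i then 1 else 0) using 1
  ext v
  rw [Set.mem_ofPred_eq, Set.mem_ofPred_eq, Finset.sum_eq_single i]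
  · simp
  · intro k _ hk
    simp [hk]
  · simp

end PolyNorm

end

theorem mainTheorem6 (n d : ℕ) (hn : 2 ≤ n) (hd : 0 < d) (hdeven : Even d) :
    (∀ f : MvPolynomial (Fin n) ℝ, f.IsHomogeneous d →
      ((∀ x : Fin n → ℝ, x ≠ 0 → (PolyNorm.hessianAt f x).PosDef) ↔
        ∃ c : ℝ, 0 < c ∧ ∃ r : ℕ,
          PolyNorm.IsRSosConvex r (f - MvPolynomial.C c * PolyNorm.normSq n ^ (d / 2)))) ∧
    (∀ r : ℕ,
      PolyNorm.IsSemidefiniteRepresentable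
        {v : PolyNorm.Expo n d → ℝ | ∃ c : ℝ, 0 < c ∧
          PolyNorm.IsRSosConvex r
            (PolyNorm.formOf v - MvPolynomial.C c * PolyNorm.normSq n ^ (d / 2))} ∧
      PolyNorm.IsSemidefiniteRepresentable
        {w : PolyNorm.Expo n d ⊕ Unit → ℝ | 0 ≤ w (Sum.inr ()) ∧
          PolyNorm.IsRSosConvex r
            (PolyNorm.formOf (fun m => w (Sum.inl m)) -
              MvPolynomial.C (w (Sum.inr ())) * PolyNorm.normSq n ^ (d / 2))}) := by
  refine ⟨fun f hf => ?_, fun r => ⟨?_, ?_⟩⟩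
  · obtain ⟨m, rfl⟩ : ∃ m, d = 2 * (m + 1) := by
      obtain ⟨k, rfl⟩ := hdeven
      exact ⟨k - 1, by omega⟩
    rw [Nat.mul_div_cancel_left _ two_pos]
    exact ⟨PolyNorm.exists_isRSosConvex_of_hessianAt_posDef hf, fun ⟨c, hc, r, h⟩ x hx =>
      PolyNorm.hessianAt_posDef_of_isRSosConvex hc h hx⟩
  -- The scalar c is one more decision variable, constrained to be positive and then projected out.
  · convert ((PolyNorm.isSemidefiniteRepresentable_pos (Sum.inr ())).inter
      (PolyNorm.isSemidefiniteRepresentable_isRSosConvex n d (d / 2) r)).proj using 1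
    ext v
    simp only [Set.mem_ofPred_eq, Set.mem_inter_iff, Sum.elim_inl, Sum.elim_inr]
    exact ⟨fun ⟨c, hc⟩ => ⟨fun _ => c, hc⟩, fun ⟨u, hu⟩ => ⟨u (), hu⟩⟩
  · exact (PolyNorm.isSemidefiniteRepresentable_nonneg (Sum.inr ())).inter
      (PolyNorm.isSemidefiniteRepresentable_isRSosConvex n d (d / 2) r)
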